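/- Let $X$ be a locally compact Polish space with its Borel $\sigma$-algebra, let $\sigma$ be a Radon (locally finite) measure on $X$, and let $X=X_1\sqcup X_2$ be a partition into two Borel sets. Put $\mathcal H=L^2(X,\sigma)$ (complex). For a Borel set $\Lambda\subset X$, let $P_\Lambda$ be the orthogonal projection of $\mathcal H$ onto $L^2(\Lambda,\sigma)$; put $P_i=P_{X_i}$, $J=P_1-P_2$, and $[f,g]=(Jf,g)_{\mathcal H}$. Let $\mathcal C$ be the complex conjugation in $\mathcal H$, and $\overline B=\mathcal C B\mathcal C$ for $B\in\mathcal L(\mathcal H)$. Let $\mathbb K\in\mathcal L(\mathcal H)$ be $J$-self-adjoint, i.e. $[\mathbb Kf,g]=[f,\mathbb Kg]$ for all $f,g\in\mathcal H$. Put $K=\mathbb KP_1+(\mathbf 1-\mathbb K)P_2$ and assume that $\mathbf 0\le K\le\mathbf 1$ and that $\mathbb K$ is locally trace-class on $X_1$ and on $X_2$: for $i=1,2$ and every pre-compact Borel set $\Lambda\subset X_i$, the operator $\mathbb K_\Lambda:=P_\Lambda\mathbb KP_\Lambda$ is of trace class. Put $K_1=\sqrt K$ and $K_2=\sqrt{\mathbf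 1-K}$. Let $\mathcal G=\mathcal H\oplus\mathcal H$, let $\mathcal G^{\wedge n}$ be the subspace of antisymmetric elements of the Hilbert space $\mathcal G^{\otimes n}$ (with $\mathcal G^{\wedge0}=\mathbb C$), and let $\mathcal A_n$ be the orthogonal projection of $\mathcal G^{\otimes n}$ onto $\mathcal G^{\wedge n}$. Let $\mathcal{AF}_{\mathrm{fin}}(\mathcal G)$ be the space of finite sequences $g=(g^{(n)})_{n\ge0}$, $g^{(n)}\in\mathcal G^{\wedge n}$, a dense subspace of the antisymmetric Fock space $\mathcal{AF}(\mathcal G)$ with squared norm $\sum_n n!\,\|g^{(n)}\|^2$. On $\mathcal{AF}_{\mathrm{fin}}(\mathcal G)$ define the following linear operators. * For $\varphi\in\mathcal G^{\otimes2}$: $a^+(\varphi)g^{(n)}=\mathcal A_{n+2}(\varphi\otimes g^{(n)})$ for $g^{(n)}\in\mathcal G^{\wedge n}$, and $a^-(\varphi)$ is the restriction to $\mathcal{AF}_{\mathrm{fin}}(\mathcal G)$ of the adjoint of $a^+(\varphi)$ in $\mathcal{AF}(\mathcal G)$. * For $B\in\mathcal L(\mathcal G)$: $d\Gamma(B)$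 acts on $\mathcal G^{\wedge n}$ as $\sum_{i=1}^n\mathbf 1^{\otimes(i-1)}\otimes B\otimes\mathbf 1^{\otimes(n-i)}$ (and as $0$ on $\mathcal G^{\wedge 0}$). For a Hilbert–Schmidt operator $T$ in $\mathcal H$ with integral kernel $T(\cdot,\cdot)\in L^2(X^2,\sigma^{\otimes2})=\mathcal H^{\otimes2}$, let $(T)_{2,1}\in\mathcal G^{\otimes2}$ be the image of this kernel under the isometry $\mathcal H^{\otimes2}\to\mathcal G^{\otimes2}$, $\varphi\otimes\psi\mapsto(0,\varphi)\otimes(\psi,0)$. For each pre-compact Borel set $\Delta\subset X$ put $J_\Delta=P_{\Delta\cap X_1}-P_{\Delta\cap X_2}$ (then $K_2J_\Delta K_1$ is a Hilbert–Schmidt operator) and $$\rho(\Delta)=a^+\big((K_2J_\Delta K_1)_{2,1}\big)+a^-\big((K_2J_\Delta K_1)_{2,1}\big)+d\Gamma\big(\overline{-K_1J_\Delta K_1}\oplus K_2J_\Delta K_2\big)+\operatorname{Tr}(\mathbb K_{\Delta\cap X_1})+\operatorname{Tr}(\mathbb K_{\Delta\cap X_2}),$$ a linear operator in $\mathcal{AF}_{\mathrm{fin}}(\mathcal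 G)$. Then, for any pre-compact Borel sets $\Delta_1,\Delta_2\subset X$, $$\rho(\Delta_1)\rho(\Delta_2)=\rho(\Delta_2)\rho(\Delta_1)\quad\text{on }\mathcal{AF}_{\mathrm{fin}}(\mathcal G).$$ -/

import Mathlib

open MeasureTheory UniformSpace
open scoped ENNReal InnerProductSpace TensorProduct

universe u

namespace ParticleDensity

noncomputable section

/-! ## Tensor powers of a complex Hilbert space -/

/-- A complex inner product space, bundled so that tensor powers can be defined by recursion. -/
structure PreHilb : Type (u + 1) where
  carrier : Type u
  [grp : NormedAddCommGroup carrier]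
  [ips : InnerProductSpace ℂ carrier]

attribute [instance] PreHilb.grp PreHilb.ips

section Fock

variable (G : Type u) [NormedAddCommGroup G] [InnerProductSpace ℂ G]

/-- The algebraic tensor powers `G ⊗ (G ⊗ (⋯ ⊗ (G ⊗ ℂ)))` with the tensor product inner product.
The zeroth power is the one-dimensional space `ℂ`, written as `EuclideanSpace ℂ PUnit` in order to
live in the same universe as `G`. -/
def preTensorPower : ℕ → PreHilb.{u}
  | 0 => ⟨EuclideanSpace ℂ PUnit.{u + 1}⟩
  | n + 1 => ⟨G ⊗[ℂ] (preTensorPower n).carrier⟩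

/-- The algebraic `n`-th tensor power of `G` with its inner product. -/
abbrev PreTensor (n : ℕ) : Type u := (preTensorPower G n).carrier

/-- `G^{⊗(n+1)} = G ⊗ G^{⊗n}` (algebraically). -/
def preSucc (n : ℕ) : PreTensor G (n + 1) ≃ₗᵢ[ℂ] G ⊗[ℂ] PreTensor G n :=
  LinearIsometryEquiv.refl ℂ (G ⊗[ℂ] PreTensor G n)

/-- The Hilbert space tensor power `G^{⊗n}`. -/
abbrev HTensor (n : ℕ) : Type u := Completion (PreTensor G n)

/-- The unitary `x ⊗ (y ⊗ t) ↦ y ⊗ (x ⊗ t)` that exchanges the first two tensor factors. -/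
def swapFirst (n : ℕ) : PreTensor G (n + 2) ≃ₗᵢ[ℂ] PreTensor G (n + 2) :=
  let e : PreTensor G (n + 2) ≃ₗᵢ[ℂ] G ⊗[ℂ] (G ⊗[ℂ] PreTensor G n) :=
    (preSucc G (n + 1)).trans ((preSucc G n).lTensor G)
  let a := TensorProduct.assocIsometry ℂ G G (PreTensor G n)
  let s := (TensorProduct.commIsometry ℂ G G).rTensor (PreTensor G n)
  e.trans (a.symm.trans (s.trans (a.trans e.symm)))

variable {G}

/-- For an operator `S` in `G^{⊗n}`, the operator `𝟏 ⊗ S` in `G^{⊗(n+1)}`. -/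
def idTensor {n : ℕ} (S : PreTensor G n →L[ℂ] PreTensor G n) :
    PreTensor G (n + 1) →L[ℂ] PreTensor G (n + 1) :=
  (preSucc G n).symm.toContinuousLinearEquiv.toContinuousLinearMap ∘L S.lTensor G ∘L
    (preSucc G n).toContinuousLinearEquiv.toContinuousLinearMap

/-- For an operator `B` in `G`, the operator `B ⊗ 𝟏` in `G^{⊗(n+1)}`. -/
def tensorId (n : ℕ) (B : G →L[ℂ] G) :
    PreTensor G (n + 1) →L[ℂ] PreTensor G (n + 1) :=
  (preSucc G n).symm.toContinuousLinearEquiv.toContinuousLinearMap ∘L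
    B.rTensor (PreTensor G n) ∘L
    (preSucc G n).toContinuousLinearEquiv.toContinuousLinearMap

variable (G)

/-- The set of the `n - 1` operators in `G^{⊗n}` that exchange two neighbouring tensor factors. -/
def adjacentSwaps : ∀ n : ℕ, Set (PreTensor G n →L[ℂ] PreTensor G n)
  | 0 => ∅
  | 1 => ∅
  | n + 2 => insert (swapFirst G n).toContinuousLinearEquiv.toContinuousLinearMap
      (idTensor '' adjacentSwaps (n + 1))

/-- The antisymmetric tensor power `G^{∧n}`: the closed subspace of those elements of `G^{⊗n}`
that change sign under the exchange of any two neighbouring tensor factors (equivalently, on which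
every permutation of the factors acts by its sign). -/
def antisymm (n : ℕ) : Submodule ℂ (HTensor G n) where
  carrier := {t | ∀ S ∈ adjacentSwaps G n, S.completion t = -t}
  zero_mem' S _ := by simp
  add_mem' ha hb S hS := by
    rw [map_add, ha S hS, hb S hS, neg_add]
  smul_mem' c t ht S hS := by
    rw [map_smul, ht S hS, smul_neg]

theorem isClosed_antisymm (n : ℕ) : IsClosed (antisymm G n : Set (HTensor G n)) := by
  have : (antisymm G n : Set (HTensor G n)) =
      ⋂ S ∈ adjacentSwaps G n, {t | S.completion t = -t} := by
    ext t
    simp [antisymm]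
  rw [this]
  exact isClosed_biInter fun S _ => isClosed_eq S.completion.continuous continuous_neg

instance instCompleteSpaceAntisymm (n : ℕ) : CompleteSpace (antisymm G n) :=
  (isClosed_antisymm G n).completeSpace_coe

/-- The antisymmetrization operator `𝒜ₙ`: the orthogonal projection of `G^{⊗n}` onto `G^{∧n}`. -/
def antisymmetrizer (n : ℕ) : HTensor G n →L[ℂ] antisymm G n :=
  (antisymm G n).orthogonalProjectionOnto

/-- The space of finite sequences `(g⁽ⁿ⁾)ₙ` with `g⁽ⁿ⁾ ∈ G^{∧n}`, a dense subspace of the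
antisymmetric Fock space, in which the squared norm of such a sequence is `∑ₙ n! ‖g⁽ⁿ⁾‖²`. -/
abbrev FockFin : Type u := DirectSum ℕ fun n => antisymm G n

variable {G}

/-! ### Two-particle creation and annihilation operators -/

/-- The canonical unitary `(G ⊗ G) ⊗ G^{⊗n} ≅ G^{⊗(n+2)}` of algebraic tensor powers. -/
def preAssoc (n : ℕ) : (G ⊗[ℂ] G) ⊗[ℂ] PreTensor G n ≃ₗᵢ[ℂ] PreTensor G (n + 2) :=
  (TensorProduct.assocIsometry ℂ G G (PreTensor G n)).trans
    ((preSucc G (n + 1)).trans ((preSucc G n).lTensor G)).symm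

/-- The operator `t ↦ φ ⊗ t`, `G^{⊗n} → G^{⊗(n+2)}`, between algebraic tensor powers, for
`φ ∈ G ⊗ G` (algebraic). -/
def preTensorLeft (n : ℕ) (φ : G ⊗[ℂ] G) : PreTensor G n →L[ℂ] PreTensor G (n + 2) :=
  (preAssoc n).toContinuousLinearEquiv.toContinuousLinearMap ∘L
    TensorProduct.mkL ℂ (G ⊗[ℂ] G) (PreTensor G n) φ

theorem preTensorLeft_apply (n : ℕ) (φ : G ⊗[ℂ] G) (t : PreTensor G n) :
    preTensorLeft n φ t = preAssoc n (φ ⊗ₜ[ℂ] t) := rfl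

theorem norm_completion_preTensorLeft_apply (n : ℕ) (φ : G ⊗[ℂ] G) (t : HTensor G n) :
    ‖(preTensorLeft n φ).completion t‖ = ‖φ‖ * ‖t‖ := by
  induction t using Completion.induction_on with
  | hp => exact isClosed_eq (by fun_prop) (by fun_prop)
  | ih t =>
    rw [ContinuousLinearMap.completion_apply_coe, Completion.norm_coe, Completion.norm_coe,
      preTensorLeft_apply, LinearIsometryEquiv.norm_map, TensorProduct.norm_tmul]

theorem completion_add {E F : Type*} [NormedAddCommGroup E] [NormedSpace ℂ E]
    [NormedAddCommGroup F] [NormedSpace ℂ F] (S T : E →L[ℂ] F) :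
    (S + T).completion = S.completion + T.completion := by
  ext t
  induction t using Completion.induction_on with
  | hp => exact isClosed_eq (by fun_prop) (by fun_prop)
  | ih t =>
    rw [add_apply, ContinuousLinearMap.completion_apply_coe,
      ContinuousLinearMap.completion_apply_coe, ContinuousLinearMap.completion_apply_coe,
      add_apply, Completion.coe_add]

theorem completion_smul {E F : Type*} [NormedAddCommGroup E] [NormedSpace ℂ E]
    [NormedAddCommGroup F] [NormedSpace ℂ F] (c : ℂ) (S : E →L[ℂ] F) :
    (c • S).completion = c • S.completion := by
  ext t
  induction t using Completion.induction_on with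
  | hp => exact isClosed_eq (c • S).completion.continuous (S.completion.continuous.const_smul c)
  | ih t =>
    have h := S.completion_apply_coe t
    change (c • S).completion t = c • S.completion t
    rw [ContinuousLinearMap.completion_apply_coe, h, ← Completion.coe_smul]
    rfl

theorem preTensorLeft_smul (n : ℕ) (c : ℂ) (φ : G ⊗[ℂ] G) :
    preTensorLeft n (c • φ) = c • preTensorLeft n φ := by
  ext t
  change preAssoc n ((c • φ) ⊗ₜ[ℂ] t) = c • preAssoc n (φ ⊗ₜ[ℂ] t)
  rw [← TensorProduct.smul_tmul', LinearIsometryEquiv.map_smul]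

variable (G) in
/-- The map `φ ↦ (t ↦ φ ⊗ t)` for `φ` in the Hilbert space `G ⊗ G` and `t ∈ G^{⊗n}`. -/
def tensorLeft (n : ℕ) : Completion (G ⊗[ℂ] G) →L[ℂ] (HTensor G n →L[ℂ] HTensor G (n + 2)) :=
  ContinuousLinearMap.fromCompletion <| LinearMap.mkContinuous
    { toFun := fun φ => (preTensorLeft n φ).completion
      map_add' := fun φ ψ => by
        rw [← completion_add, preTensorLeft, map_add, ContinuousLinearMap.comp_add]
        rfl
      map_smul' := fun c φ => by
        rw [RingHom.id_apply, ← completion_smul, preTensorLeft_smul] }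
    1 fun φ => by
      rw [one_mul]
      exact ContinuousLinearMap.opNorm_le_bound _ (norm_nonneg _) fun t =>
        (norm_completion_preTensorLeft_apply n φ t).le

/-- `a⁺(φ)` on `G^{∧n}`: `a⁺(φ) g⁽ⁿ⁾ = 𝒜ₙ₊₂(φ ⊗ g⁽ⁿ⁾)`, for `φ ∈ G^{⊗2}`. -/
def create₂Aux (φ : Completion (G ⊗[ℂ] G)) (n : ℕ) : antisymm G n →L[ℂ] antisymm G (n + 2) :=
  antisymmetrizer G (n + 2) ∘L tensorLeft G n φ ∘L (antisymm G n).subtypeL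

/-- The two-particle creation operator `a⁺(φ)`, `φ ∈ G^{⊗2}`. -/
def create₂ (φ : Completion (G ⊗[ℂ] G)) : FockFin G →ₗ[ℂ] FockFin G :=
  DirectSum.toModule ℂ ℕ (FockFin G) fun n =>
    DirectSum.lof ℂ ℕ (fun k => antisymm G k) (n + 2) ∘ₗ (create₂Aux φ n).toLinearMap

/-- `a⁻(φ)` on `G^{∧n}`. Since the Fock space norm carries the weight `n!` on `G^{∧n}`, the adjoint
of `a⁺(φ) : G^{∧n} → G^{∧(n+2)}` is `(n+2)!/n! = (n+2)(n+1)` times the adjoint with respect to the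
unweighted inner products. -/
def annihilate₂Aux (φ : Completion (G ⊗[ℂ] G)) : ∀ n : ℕ, antisymm G n →ₗ[ℂ] FockFin G
  | 0 => 0
  | 1 => 0
  | n + 2 => DirectSum.lof ℂ ℕ (fun k => antisymm G k) n ∘ₗ
      ((((n : ℂ) + 2) * ((n : ℂ) + 1)) • (ContinuousLinearMap.adjoint (create₂Aux φ n))).toLinearMap

/-- The two-particle annihilation operator `a⁻(φ)`, `φ ∈ G^{⊗2}`: the restriction to `FockFin G` of
the adjoint of `a⁺(φ)` in the Fock space. -/
def annihilate₂ (φ : Completion (G ⊗[ℂ] G)) : FockFin G →ₗ[ℂ] FockFin G :=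
  DirectSum.toModule ℂ ℕ (FockFin G) (annihilate₂Aux φ)

/-- The inner product of the Fock space, on finite sequences. -/
def fockInner (f g : FockFin G) : ℂ :=
  DirectSum.toModule ℂ ℕ ℂ
    (fun n => (n.factorial : ℂ) • (innerSL ℂ (f n) : antisymm G n →L[ℂ] ℂ).toLinearMap) g

/-- `a⁻(φ)` is the (formal) adjoint of `a⁺(φ)`. -/
theorem fockInner_annihilate₂ (φ : Completion (G ⊗[ℂ] G)) (f g : FockFin G) :
    fockInner (annihilate₂ φ f) g = fockInner f (create₂ φ g) := by
  classical
  have hlof : ∀ (n : ℕ) (x : antisymm G n) (m : ℕ) (y : antisymm G m),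
      fockInner (DirectSum.lof ℂ ℕ (fun k => antisymm G k) n x)
        (DirectSum.lof ℂ ℕ (fun k => antisymm G k) m y) =
        (m.factorial : ℂ) * ⟪DirectSum.lof ℂ ℕ (fun k => antisymm G k) n x m, y⟫_ℂ := by
    intro n x m y
    simp only [fockInner, DirectSum.toModule_lof]
    rfl
  have hadd : ∀ f₁ f₂ g : FockFin G, fockInner (f₁ + f₂) g = fockInner f₁ g + fockInner f₂ g := by
    intro f₁ f₂ g
    unfold fockInner
    rw [← LinearMap.add_apply]
    congr 1
    apply DirectSum.linearMap_ext
    intro n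
    ext y
    simp [DirectSum.toModule_lof]
  have hzero : ∀ g : FockFin G, fockInner 0 g = 0 := fun g => by
    simpa using hadd 0 0 g
  have hne : ∀ (n m : ℕ) (x : antisymm G n), m ≠ n →
      DirectSum.lof ℂ ℕ (fun k => antisymm G k) n x m = 0 := fun n m x h => by
    exact DirectSum.of_eq_of_ne (β := fun k => antisymm G k) n m x h
  induction f using DirectSum.induction_on with
  | zero => rw [map_zero, hzero, hzero]
  | add f₁ f₂ h₁ h₂ => rw [map_add, hadd, hadd, h₁, h₂]
  | of n x =>
    induction g using DirectSum.induction_on with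
    | zero => simp [fockInner]
    | add g₁ g₂ h₁ h₂ =>
      have : ∀ f : FockFin G, ∀ g₁ g₂, fockInner f (g₁ + g₂) = fockInner f g₁ + fockInner f g₂ := by
        intro f g₁ g₂
        exact map_add _ _ _
      rw [(create₂ φ).map_add, this, this, h₁, h₂]
    | of m y =>
      rw [← DirectSum.lof_eq_of ℂ, ← DirectSum.lof_eq_of ℂ]
      have h1 : create₂ φ (DirectSum.lof ℂ ℕ (fun k => antisymm G k) m y) =
          DirectSum.lof ℂ ℕ (fun k => antisymm G k) (m + 2) (create₂Aux φ m y) := by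
        rw [create₂, DirectSum.toModule_lof]
        rfl
      have h2 : annihilate₂ φ (DirectSum.lof ℂ ℕ (fun k => antisymm G k) n x) =
          annihilate₂Aux φ n x := by
        rw [annihilate₂, DirectSum.toModule_lof]
      rw [h1, h2]
      rw [hlof]
      match n, x with
      | 0, x =>
        rw [hne 0 (m + 2) x (by omega)]
        rw [annihilate₂Aux, LinearMap.zero_apply, hzero, inner_zero_left, mul_zero]
      | 1, x =>
        rw [hne 1 (m + 2) x (by omega)]
        rw [annihilate₂Aux, LinearMap.zero_apply, hzero, inner_zero_left, mul_zero]
      | k + 2, x =>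
        have h3 : annihilate₂Aux φ (k + 2) x = DirectSum.lof ℂ ℕ (fun k => antisymm G k) k
            ((((k : ℂ) + 2) * ((k : ℂ) + 1)) • (ContinuousLinearMap.adjoint (create₂Aux φ k)) x) :=
          rfl
        rw [h3, hlof]
        by_cases hmk : m = k
        · subst hmk
          have h4 : ∀ (c : ℂ) (z w : antisymm G m), ⟪c • z, w⟫_ℂ = starRingEnd ℂ c * ⟪z, w⟫_ℂ :=
            fun c z w => inner_smul_left z w c
          rw [DirectSum.lof_apply, DirectSum.lof_apply, h4,
            ContinuousLinearMap.adjoint_inner_left, Nat.factorial_succ, Nat.factorial_succ]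
          simp only [map_mul, map_add, Complex.conj_natCast, map_ofNat, map_one]
          push_cast
          ring
        · rw [hne k m _ hmk, hne (k + 2) (m + 2) _ (by omega), inner_zero_left, inner_zero_left,
            mul_zero, mul_zero]

/-! ### Differential second quantization -/

/-- `∑ᵢ 𝟏 ⊗ ⋯ ⊗ B ⊗ ⋯ ⊗ 𝟏` in `G^{⊗n}`. -/
def preDGamma (B : G →L[ℂ] G) : ∀ n : ℕ, PreTensor G n →L[ℂ] PreTensor G n
  | 0 => 0
  | n + 1 => tensorId n B + idTensor (preDGamma B n)

theorem preTensor_ext {n : ℕ} {F : Type*} [AddCommGroup F] [Module ℂ F] [TopologicalSpace F]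
    {S T : PreTensor G (n + 1) →L[ℂ] F}
    (h : ∀ (x : G) (t : PreTensor G n),
      S ((preSucc G n).symm (x ⊗ₜ[ℂ] t)) = T ((preSucc G n).symm (x ⊗ₜ[ℂ] t))) : S = T := by
  ext v
  obtain ⟨w, rfl⟩ := (preSucc G n).symm.surjective v
  induction w with
  | zero => simp
  | tmul x t => exact h x t
  | add a b ha hb => rw [map_add, map_add, map_add, ha, hb]

theorem tensorId_tmul (n : ℕ) (B : G →L[ℂ] G) (x : G) (t : PreTensor G n) :
    tensorId n B ((preSucc G n).symm (x ⊗ₜ[ℂ] t)) = (preSucc G n).symm (B x ⊗ₜ[ℂ] t) := rfl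

theorem idTensor_tmul {n : ℕ} (S : PreTensor G n →L[ℂ] PreTensor G n) (x : G)
    (t : PreTensor G n) :
    idTensor S ((preSucc G n).symm (x ⊗ₜ[ℂ] t)) = (preSucc G n).symm (x ⊗ₜ[ℂ] S t) := rfl

theorem swapFirst_tmul (n : ℕ) (x y : G) (t : PreTensor G n) :
    swapFirst G n ((preSucc G (n + 1)).symm (x ⊗ₜ[ℂ] (preSucc G n).symm (y ⊗ₜ[ℂ] t))) =
      (preSucc G (n + 1)).symm (y ⊗ₜ[ℂ] (preSucc G n).symm (x ⊗ₜ[ℂ] t)) := rfl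

theorem adjacentSwaps_comm_preDGamma (B : G →L[ℂ] G) (n : ℕ) :
    ∀ S ∈ adjacentSwaps G n, S ∘L preDGamma B n = preDGamma B n ∘L S := by
  induction n with
  | zero => intro S hS; exact hS.elim
  | succ n ih =>
    cases n with
    | zero => intro S hS; exact hS.elim
    | succ n =>
      rintro S (rfl | ⟨S, hS, rfl⟩)
      · apply preTensor_ext
        intro x v
        obtain ⟨w, rfl⟩ := (preSucc G n).symm.surjective v
        induction w with
        | zero => simp
        | add a b ha hb => simp only [map_add, TensorProduct.tmul_add] at ha hb ⊢; rw [ha, hb]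
        | tmul y t =>
          have h : ∀ (x y : G) (t : PreTensor G n), preDGamma B (n + 2)
              ((preSucc G (n + 1)).symm (x ⊗ₜ[ℂ] (preSucc G n).symm (y ⊗ₜ[ℂ] t))) =
              (preSucc G (n + 1)).symm (B x ⊗ₜ[ℂ] (preSucc G n).symm (y ⊗ₜ[ℂ] t)) +
              ((preSucc G (n + 1)).symm (x ⊗ₜ[ℂ] (preSucc G n).symm (B y ⊗ₜ[ℂ] t)) +
              (preSucc G (n + 1)).symm
                (x ⊗ₜ[ℂ] (preSucc G n).symm (y ⊗ₜ[ℂ] preDGamma B n t))) := by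
            intro x y t
            rw [preDGamma, add_apply, tensorId_tmul, idTensor_tmul, preDGamma, add_apply,
              tensorId_tmul, idTensor_tmul, TensorProduct.tmul_add, map_add]
          change swapFirst G n (preDGamma B (n + 2) _) = preDGamma B (n + 2) (swapFirst G n _)
          rw [swapFirst_tmul, h, h, map_add, map_add, swapFirst_tmul, swapFirst_tmul,
            swapFirst_tmul]
          abel
      · apply preTensor_ext
        intro x v
        have h := DFunLike.congr_fun (ih S hS) v
        simp only [ContinuousLinearMap.comp_apply] at h ⊢
        rw [preDGamma, add_apply, add_apply, map_add, tensorId_tmul, idTensor_tmul, idTensor_tmul,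
          idTensor_tmul, idTensor_tmul, tensorId_tmul, idTensor_tmul, h]

/-- `∑ᵢ 𝟏 ⊗ ⋯ ⊗ B ⊗ ⋯ ⊗ 𝟏` leaves `G^{∧n}` invariant. -/
theorem preDGamma_mem (B : G →L[ℂ] G) (n : ℕ) (t : antisymm G n) :
    (preDGamma B n).completion t ∈ antisymm G n := by
  intro S hS
  have hcomm : ∀ v : HTensor G n,
      S.completion ((preDGamma B n).completion v) = (preDGamma B n).completion (S.completion v) := by
    intro v
    induction v using Completion.induction_on with
    | hp =>
      exact isClosed_eq (S.completion.continuous.comp (preDGamma B n).completion.continuous)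
        ((preDGamma B n).completion.continuous.comp S.completion.continuous)
    | ih v =>
      simp only [ContinuousLinearMap.completion_apply_coe]
      exact congrArg _ (DFunLike.congr_fun (adjacentSwaps_comm_preDGamma B n S hS) v)
  rw [hcomm, t.2 S hS, map_neg]

/-- The differential second quantization `dΓ(B)`: on `G^{∧n}` it is the operator
`g₁ ∧ ⋯ ∧ gₙ ↦ ∑ᵢ g₁ ∧ ⋯ ∧ B gᵢ ∧ ⋯ ∧ gₙ`, and it annihilates the vacuum. -/
def dGamma (B : G →L[ℂ] G) : FockFin G →ₗ[ℂ] FockFin G :=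
  DirectSum.toModule ℂ ℕ (FockFin G) fun n =>
    DirectSum.lof ℂ ℕ (fun k => antisymm G k) n ∘ₗ
      (((preDGamma B n).completion ∘L (antisymm G n).subtypeL).codRestrict (antisymm G n)
        (preDGamma_mem B n)).toLinearMap

end Fock

/-! ## Trace-class operators -/

section Trace

variable {H : Type u} [NormedAddCommGroup H] [InnerProductSpace ℂ H] [CompleteSpace H]

/-- `A` is of trace class: `∑ᵢ (|A| eᵢ, eᵢ) < ∞` for every (equivalently, for one) orthonormal
basis, where `|A| = √(A* A)`. -/
def IsTraceClass (A : H →L[ℂ] H) : Prop :=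
  ∀ (ι : Type u) (e : HilbertBasis ι ℂ H), Summable fun i => ⟪e i, CFC.abs A (e i)⟫_ℂ

/-- The trace `∑ᵢ (A eᵢ, eᵢ)`, computed in some orthonormal basis; for a trace-class operator it
does not depend on the basis. -/
def opTrace (A : H →L[ℂ] H) : ℂ :=
  ∑' e : (exists_hilbertBasis ℂ H).choose, ⟪(e : H), A e⟫_ℂ

/-- The square root of a non-negative bounded operator. -/
def opSqrt (A : H →L[ℂ] H) : H →L[ℂ] H := CFC.sqrt A

end Trace

/-! ## The space `L²(X, σ)` -/

section L2

variable {X : Type u} [MeasurableSpace X] (σ : Measure X)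

/-- The complex Hilbert space `L²(X, σ)`. -/
abbrev L2 : Type u := Lp ℂ 2 σ

variable {σ} in
theorem conj_add (f g : L2 σ) : star (f + g) = star f + star g := by
  apply Lp.ext
  filter_upwards [Lp.coeFn_star (f + g), Lp.coeFn_star f, Lp.coeFn_star g, Lp.coeFn_add f g,
    Lp.coeFn_add (star f) (star g)] with x h1 h2 h3 h4 h5
  rw [h1, h5, Pi.star_apply, h4, Pi.add_apply, Pi.add_apply, h2, h3, star_add, Pi.star_apply,
    Pi.star_apply]

variable {σ} in
theorem conj_smul (c : ℂ) (f : L2 σ) : star (c • f) = starRingEnd ℂ c • star f := by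
  apply Lp.ext
  filter_upwards [Lp.coeFn_star (c • f), Lp.coeFn_star f, Lp.coeFn_smul c f,
    Lp.coeFn_smul (starRingEnd ℂ c) (star f)] with x h1 h2 h3 h4
  simp [h1, h2, h3, h4]

variable {σ} in
theorem norm_conj_eq (f : L2 σ) : ‖star f‖ = ‖f‖ := by
  apply le_antisymm <;> apply Lp.norm_le_norm_of_ae_le <;>
    filter_upwards [Lp.coeFn_star f] with x h <;> simp [h]

/-- The complex conjugation `(𝒞 φ)(x) = conj (φ x)` in `L²(X, σ)`. -/
def conjL2 : L2 σ →L⋆[ℂ] L2 σ :=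
  LinearMap.mkContinuous
    { toFun := fun f => star f
      map_add' := conj_add
      map_smul' := conj_smul } 1 fun f => by
    rw [one_mul]
    exact (norm_conj_eq f).le

/-- `L²(Δ, σ)` as the closed subspace of those elements of `L²(X, σ)` that vanish almost everywhere
outside of `Δ`. -/
def L2On (Δ : Set X) : Submodule ℂ (L2 σ) where
  carrier := {f | f =ᵐ[σ.restrict Δᶜ] 0}
  zero_mem' := ae_restrict_of_ae (Lp.coeFn_zero ℂ 2 σ)
  add_mem' {f g} hf hg := by
    filter_upwards [hf, hg, ae_restrict_of_ae (Lp.coeFn_add f g)] with x h1 h2 h3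
    rw [h3, Pi.add_apply, h1, h2, Pi.zero_apply, add_zero]
  smul_mem' c f hf := by
    filter_upwards [hf, ae_restrict_of_ae (Lp.coeFn_smul c f)] with x h1 h2
    simp [h1, h2]

theorem isClosed_L2On (Δ : Set X) : IsClosed (L2On σ Δ : Set (L2 σ)) := by
  have : (L2On σ Δ : Set (L2 σ)) = LpToLpRestrictCLM X ℂ ℂ σ 2 Δᶜ ⁻¹' {0} := by
    ext f
    have h := LpToLpRestrictCLM_coeFn ℂ Δᶜ f
    simp only [Set.mem_preimage, Set.mem_singleton_iff]
    change f =ᵐ[σ.restrict Δᶜ] 0 ↔ _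
    rw [Lp.eq_zero_iff_ae_eq_zero]
    exact ⟨fun h' => h.trans h', fun h' => h.symm.trans h'⟩
  rw [this]
  exact isClosed_singleton.preimage (ContinuousLinearMap.continuous _)

instance instCompleteSpaceL2On (Δ : Set X) : CompleteSpace (L2On σ Δ) :=
  (isClosed_L2On σ Δ).completeSpace_coe

/-- `P_Δ`, the orthogonal projection of `L²(X, σ)` onto `L²(Δ, σ)`. -/
def proj (Δ : Set X) : L2 σ →L[ℂ] L2 σ := (L2On σ Δ).starProjection

variable {σ}

/-- `k ∈ L²(X, σ) ⊗ L²(X, σ) = L²(X², σ ⊗ σ)` is the integral kernel of the operator `T`. In terms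
of the kernel, both sides are equal to `∫∫ k(x, y) conj (φ x) conj (ψ y) σ(dx) σ(dy)`. -/
def IsKernelTensor (T : L2 σ →L[ℂ] L2 σ) (k : Completion (L2 σ ⊗[ℂ] L2 σ)) : Prop :=
  ∀ φ ψ : L2 σ, ⟪((φ ⊗ₜ[ℂ] ψ : L2 σ ⊗[ℂ] L2 σ) : Completion (L2 σ ⊗[ℂ] L2 σ)), k⟫_ℂ =
    ⟪φ, T (conjL2 σ ψ)⟫_ℂ

open Classical in
/-- The integral kernel of a Hilbert–Schmidt operator `T` as an element of
`L²(X, σ) ⊗ L²(X, σ)`. -/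
def kernelTensor (T : L2 σ →L[ℂ] L2 σ) : Completion (L2 σ ⊗[ℂ] L2 σ) :=
  if h : ∃ k, IsKernelTensor T k then h.choose else 0

theorem IsKernelTensor.unique {T : L2 σ →L[ℂ] L2 σ} {k l : Completion (L2 σ ⊗[ℂ] L2 σ)}
    (hk : IsKernelTensor T k) (hl : IsKernelTensor T l) : k = l := by
  have h : ∀ v : Completion (L2 σ ⊗[ℂ] L2 σ), ⟪v, k⟫_ℂ = ⟪v, l⟫_ℂ := by
    intro v
    induction v using Completion.induction_on with
    | hp => exact isClosed_eq (by fun_prop) (by fun_prop)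
    | ih v =>
      induction v with
      | zero => rw [Completion.coe_zero, inner_zero_left, inner_zero_left]
      | tmul φ ψ => rw [hk, hl]
      | add a b ha hb => rw [Completion.coe_add, inner_add_left, inner_add_left, ha, hb]
  exact ext_inner_left ℂ h

theorem inner_conjL2 (f g : L2 σ) : ⟪conjL2 σ f, conjL2 σ g⟫_ℂ = ⟪g, f⟫_ℂ := by
  change ⟪star f, star g⟫_ℂ = _
  rw [L2.inner_def, L2.inner_def]
  apply integral_congr_ae
  filter_upwards [Lp.coeFn_star f, Lp.coeFn_star g] with x h1 h2
  simp [h1, h2, mul_comm]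

theorem conjL2_conjL2 (f : L2 σ) : conjL2 σ (conjL2 σ f) = f := star_star f

/-- Every Hilbert–Schmidt operator has an integral kernel. -/
theorem exists_isKernelTensor {ι : Type*} (e : HilbertBasis ι ℂ (L2 σ)) {T : L2 σ →L[ℂ] L2 σ}
    (hT : Summable fun i => ‖T (e i)‖ ^ 2) : IsKernelTensor T (kernelTensor T) := by
  suffices h : ∃ k, IsKernelTensor T k by
    rw [kernelTensor, dif_pos h]
    exact h.choose_spec
  let V : ι → L2 σ →ₗᵢ[ℂ] Completion (L2 σ ⊗[ℂ] L2 σ) := fun i =>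
    { toLinearMap := (Completion.toComplL (𝕜 := ℂ) (E := L2 σ ⊗[ℂ] L2 σ)).toLinearMap ∘ₗ
        (TensorProduct.mk ℂ (L2 σ) (L2 σ)).flip (conjL2 σ (e i))
      norm_map' := fun x => by
        have h1 : ‖conjL2 σ (e i)‖ = 1 := (norm_conj_eq (e i)).trans (e.orthonormal.1 i)
        change ‖((x ⊗ₜ[ℂ] conjL2 σ (e i) : L2 σ ⊗[ℂ] L2 σ) : Completion (L2 σ ⊗[ℂ] L2 σ))‖ = ‖x‖
        rw [Completion.norm_coe, TensorProduct.norm_tmul, h1, mul_one] }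
  have hV : ∀ i x, V i x =
    ((x ⊗ₜ[ℂ] conjL2 σ (e i) : L2 σ ⊗[ℂ] L2 σ) : Completion (L2 σ ⊗[ℂ] L2 σ)) := fun _ _ => rfl
  have horth : OrthogonalFamily ℂ (fun _ : ι => L2 σ) V := by
    intro i j hij x y
    rw [hV, hV, Completion.inner_coe, TensorProduct.inner_tmul, inner_conjL2,
      e.orthonormal.2 hij.symm, mul_zero]
  have hs : Summable fun i => V i (T (e i)) := (horth.summable_iff_norm_sq_summable _).2 hT
  refine ⟨∑' i, V i (T (e i)), fun φ ψ => ?_⟩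
  have h1 := hs.hasSum.mapL (innerSL ℂ
    ((φ ⊗ₜ[ℂ] ψ : L2 σ ⊗[ℂ] L2 σ) : Completion (L2 σ ⊗[ℂ] L2 σ)))
  have h2 := ((e.hasSum_repr (conjL2 σ ψ)).mapL T).mapL (innerSL ℂ φ)
  have h3 : (fun i => innerSL ℂ φ (T (e.repr (conjL2 σ ψ) i • e i))) = fun i => innerSL ℂ
      ((φ ⊗ₜ[ℂ] ψ : L2 σ ⊗[ℂ] L2 σ) : Completion (L2 σ ⊗[ℂ] L2 σ)) (V i (T (e i))) := by
    funext i
    rw [hV, innerSL_apply_apply, innerSL_apply_apply, Completion.inner_coe,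
      TensorProduct.inner_tmul, map_smul, inner_smul_right, e.repr_apply_apply,
      ← inner_conjL2 (conjL2 σ ψ), conjL2_conjL2, mul_comm]
  rw [h3] at h2
  exact h1.unique h2

end L2

/-! ## The particle density -/

section Density

variable {X : Type u} [MeasurableSpace X] (σ : Measure X)

/-- `𝒢 = ℋ ⊕ ℋ` with `ℋ = L²(X, σ)`. -/
abbrev G2 : Type u := WithLp 2 (L2 σ × L2 σ)

variable {σ}

/-- `φ ↦ (φ, 0)`. -/
def incl₁ : L2 σ →L[ℂ] G2 σ :=
  (WithLp.prodContinuousLinearEquiv 2 ℂ (L2 σ) (L2 σ)).symm.toContinuousLinearMap ∘L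
    ContinuousLinearMap.inl ℂ (L2 σ) (L2 σ)

/-- `φ ↦ (0, φ)`. -/
def incl₂ : L2 σ →L[ℂ] G2 σ :=
  (WithLp.prodContinuousLinearEquiv 2 ℂ (L2 σ) (L2 σ)).symm.toContinuousLinearMap ∘L
    ContinuousLinearMap.inr ℂ (L2 σ) (L2 σ)

/-- The isometry `ℐ₂₁ : ℋ ⊗ ℋ → 𝒢 ⊗ 𝒢`, `φ ⊗ ψ ↦ (0, φ) ⊗ (ψ, 0)`. -/
def embed₂₁ : Completion (L2 σ ⊗[ℂ] L2 σ) →L[ℂ] Completion (G2 σ ⊗[ℂ] G2 σ) :=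
  (TensorProduct.mapL (incl₂ (σ := σ)) (incl₁ (σ := σ))).completion

/-- The operator `B ⊕ D` in `𝒢 = ℋ ⊕ ℋ`. -/
def opSum (B D : L2 σ →L[ℂ] L2 σ) : G2 σ →L[ℂ] G2 σ :=
  (WithLp.prodContinuousLinearEquiv 2 ℂ (L2 σ) (L2 σ)).symm.toContinuousLinearMap ∘L
    B.prodMap D ∘L
    (WithLp.prodContinuousLinearEquiv 2 ℂ (L2 σ) (L2 σ)).toContinuousLinearMap

/-- The complex conjugate `𝒞 B 𝒞` of the operator `B`. -/
def conjOp (B : L2 σ →L[ℂ] L2 σ) : L2 σ →L[ℂ] L2 σ :=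
  (conjL2 σ).comp (B.comp (conjL2 σ))

variable (X₁ X₂ : Set X)

/-- `P_{Δ ∩ X₁} - P_{Δ ∩ X₂}`. -/
def jProj (σ : Measure X) (X₁ X₂ Δ : Set X) : L2 σ →L[ℂ] L2 σ :=
  proj σ (Δ ∩ X₁) - proj σ (Δ ∩ X₂)

/-- The indefinite scalar product `[f, g] = (J f, g)`, where `J = P₁ - P₂` and `Pᵢ` is the
projection onto `L²(Xᵢ, σ)`; it is linear in `f` and antilinear in `g`. -/
def jInner (f g : L2 σ) : ℂ := ⟪g, (proj σ X₁ - proj σ X₂) f⟫_ℂ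

/-- `A` is `J`-self-adjoint. -/
def IsJSelfAdjoint (A : L2 σ →L[ℂ] L2 σ) : Prop :=
  ∀ f g : L2 σ, jInner X₁ X₂ (A f) g = jInner X₁ X₂ f (A g)

/-- `Â = A P₁ + (𝟏 - A) P₂`. -/
def hatOp (A : L2 σ →L[ℂ] L2 σ) : L2 σ →L[ℂ] L2 σ :=
  A * proj σ X₁ + (1 - A) * proj σ X₂

/-- `Δ` is a pre-compact Borel set. -/
def IsPrecompact [TopologicalSpace X] (Δ : Set X) : Prop :=
  MeasurableSet Δ ∧ IsCompact (closure Δ)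

/-- `A` is locally trace-class on the subset `Y` of `X`. -/
def IsLocallyTraceClassOn [TopologicalSpace X] (A : L2 σ →L[ℂ] L2 σ) (Y : Set X) : Prop :=
  ∀ Δ : Set X, IsPrecompact Δ → Δ ⊆ Y → IsTraceClass (proj σ Δ * A * proj σ Δ)

/-- The particle density `ρ(Δ)` of the operator `A = 𝕂`, a linear operator in the space of finite
sequences of the antisymmetric Fock space over `ℋ ⊕ ℋ`. With `K = Â`, `K₁ = √K`, `K₂ = √(𝟏 - K)` and
`J_Δ = P_{Δ ∩ X₁} - P_{Δ ∩ X₂}`,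
`ρ(Δ) = a⁺((K₂ J_Δ K₁)₂₁) + a⁻((K₂ J_Δ K₁)₂₁) + dΓ(conj (-K₁ J_Δ K₁) ⊕ K₂ J_Δ K₂)
  + Tr(𝕂_{Δ ∩ X₁}) + Tr(𝕂_{Δ ∩ X₂})`, where `𝕂_Λ = P_Λ 𝕂 P_Λ`. -/
def particleDensity (A : L2 σ →L[ℂ] L2 σ) (Δ : Set X) : Module.End ℂ (FockFin (G2 σ)) :=
  let K₁ := opSqrt (hatOp X₁ X₂ A)
  let K₂ := opSqrt (1 - hatOp X₁ X₂ A)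
  let JΔ := jProj σ X₁ X₂ Δ
  let k := embed₂₁ (kernelTensor (K₂ * JΔ * K₁))
  create₂ k + annihilate₂ k + dGamma (opSum (conjOp (-(K₁ * JΔ * K₁))) (K₂ * JΔ * K₂)) +
    (opTrace (proj σ (Δ ∩ X₁) * A * proj σ (Δ ∩ X₁)) +
      opTrace (proj σ (Δ ∩ X₂) * A * proj σ (Δ ∩ X₂))) • (1 : Module.End ℂ (FockFin (G2 σ)))

end Density

end

end ParticleDensity

open ParticleDensity

/-!
The particle density `ρ(Δ)` is a quadratic expression in fermionic creation and annihilation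
operators plus a scalar, so the commutator `[ρ(Δ₁), ρ(Δ₂)]` is computed with the canonical
anticommutation relations. Write `a = K₁`, `b = K₂`, `jᵢ = J_{Δᵢ}` and `Tᵢ = b jᵢ a`. The commutator is
the sum of

* a creation part and an annihilation part, from the commutators of `dΓ` with `a⁺` and with `a⁻`: the
  operator whose kernel is created is symmetric in the two sets (`kernel_term_symm`);
* a number-preserving part, from `[dΓ, dΓ]` and `[a⁻, a⁺]`: it vanishes by `commutator_term_left` and
  `commutator_term_right`;
* a scalar part `⟨T₁, T₂⟩ - ⟨T₂, T₁⟩`, with the Hilbert–Schmidt inner product: it vanishes because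
  `⟨T₁, T₂⟩` is real (`hsInner_comm`).

The first two points use only `a² + b² = 1` and `j₁ j₂ = j₂ j₁`. For the third, the trace-class
condition says that `a P_{Δᵢ ∩ X₁}` and `b P_{Δᵢ ∩ X₂}` are Hilbert–Schmidt; `⟨T₁, T₂⟩` splits into
four terms, each of which is brought into a visibly symmetric or real form by moving factors through
the inner product and by taking adjoints. That `𝕂` is `J`-self-adjoint means that `K` is
self-adjoint, which is contained in `0 ≤ K`.

The anticommutation relations are derived from the alternating insertion `insertAlt f`, which is
`n + 1` times the antisymmetrization of `f ⊗ ·` on antisymmetric tensors of order `n`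
(`antisymmetrizer_consL`) but is defined on all tensors by the recursion
`insertAlt f (x ⊗ t) = f ⊗ x ⊗ t - x ⊗ insertAlt f t`. Its relations with the contraction of the first
factor, with itself and with `dΓ(B)` hold on the whole tensor power and follow from the recursion.
Relations between two-particle operators are checked on elementary tensors, where `a^±` factor into
one-particle operators, and extended by density; `kernelOp`, which recovers a bounded operator from its
kernel, makes both sides continuous in the kernels (`annihilate₂_mul_create₂_of_isHS`).
-/

namespace ParticleDensity

noncomputable section

section Creation

variable {G : Type u} [NormedAddCommGroup G] [InnerProductSpace ℂ G]

/-! ### Insertion and contraction on algebraic tensor powers -/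

/-- The element `x ⊗ t` of `G^{⊗(n+1)}`. -/
def cons {n : ℕ} (x : G) (t : PreTensor G n) : PreTensor G (n + 1) :=
  (preSucc G n).symm (x ⊗ₜ[ℂ] t)

/-- The operator `t ↦ f ⊗ t`. -/
def consL (f : G) (n : ℕ) : PreTensor G n →L[ℂ] PreTensor G (n + 1) :=
  (preSucc G n).symm.toContinuousLinearEquiv.toContinuousLinearMap ∘L
    TensorProduct.mkL ℂ G (PreTensor G n) f

/-- The operator `𝟏 ⊗ S`, for an operator `S` between tensor powers of different order. -/
def oneTensor {m n : ℕ} (S : PreTensor G m →L[ℂ] PreTensor G n) :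
    PreTensor G (m + 1) →L[ℂ] PreTensor G (n + 1) :=
  (preSucc G n).symm.toContinuousLinearEquiv.toContinuousLinearMap ∘L S.lTensor G ∘L
    (preSucc G m).toContinuousLinearEquiv.toContinuousLinearMap

/-- The contraction `x ⊗ t ↦ (f, x) t` of the first tensor factor with `f`. -/
def contract (f : G) (n : ℕ) : PreTensor G (n + 1) →L[ℂ] PreTensor G n :=
  (TensorProduct.lidIsometry ℂ (PreTensor G n)).toContinuousLinearEquiv.toContinuousLinearMap ∘L
    (innerSL ℂ f).rTensor (PreTensor G n) ∘L
    (preSucc G n).toContinuousLinearEquiv.toContinuousLinearMap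

/-- The alternating insertion
`x₁ ⊗ ⋯ ⊗ xₙ ↦ ∑ⱼ (-1)ʲ x₁ ⊗ ⋯ ⊗ xⱼ ⊗ f ⊗ xⱼ₊₁ ⊗ ⋯ ⊗ xₙ`. -/
def insertAlt (f : G) : ∀ n : ℕ, PreTensor G n →L[ℂ] PreTensor G (n + 1)
  | 0 => consL f 0
  | n + 1 => consL f (n + 1) - oneTensor (insertAlt f n)

theorem consL_apply (f : G) {n : ℕ} (t : PreTensor G n) : consL f n t = cons f t := rfl

theorem oneTensor_cons {m n : ℕ} (S : PreTensor G m →L[ℂ] PreTensor G n) (x : G)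
    (t : PreTensor G m) : oneTensor S (cons x t) = cons x (S t) := rfl

theorem idTensor_cons {n : ℕ} (S : PreTensor G n →L[ℂ] PreTensor G n) (x : G)
    (t : PreTensor G n) : idTensor S (cons x t) = cons x (S t) := rfl

theorem contract_cons (f x : G) {n : ℕ} (t : PreTensor G n) :
    contract f n (cons x t) = ⟪f, x⟫_ℂ • t := rfl

theorem swapFirst_cons {n : ℕ} (x y : G) (t : PreTensor G n) :
    swapFirst G n (cons x (cons y t)) = cons y (cons x t) := rfl

theorem cons_add {n : ℕ} (x : G) (s t : PreTensor G n) : cons x (s + t) = cons x s + cons x t :=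
  map_add (consL x n) s t

theorem cons_sub {n : ℕ} (x : G) (s t : PreTensor G n) : cons x (s - t) = cons x s - cons x t :=
  map_sub (consL x n) s t

theorem cons_neg {n : ℕ} (x : G) (t : PreTensor G n) : cons x (-t) = -cons x t :=
  map_neg (consL x n) t

theorem cons_zero {n : ℕ} (x : G) : cons x (0 : PreTensor G n) = 0 := map_zero (consL x n)

theorem cons_smul {n : ℕ} (c : ℂ) (x : G) (t : PreTensor G n) :
    cons x (c • t) = c • cons x t := map_smul (consL x n) c t

theorem cons_add_left {n : ℕ} (x y : G) (t : PreTensor G n) :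
    cons (x + y) t = cons x t + cons y t := by
  simp only [cons, TensorProduct.add_tmul, map_add]

theorem cons_smul_left {n : ℕ} (c : ℂ) (x : G) (t : PreTensor G n) :
    cons (c • x) t = c • cons x t := by
  rw [← cons_smul]
  simp only [cons, TensorProduct.smul_tmul]

theorem inner_cons {n : ℕ} (x y : G) (s t : PreTensor G n) :
    ⟪cons x s, cons y t⟫_ℂ = ⟪x, y⟫_ℂ * ⟪s, t⟫_ℂ := by
  rw [cons, cons, LinearIsometryEquiv.inner_map_map, TensorProduct.inner_tmul]

theorem cons_induction {n : ℕ} {p : PreTensor G (n + 1) → Prop} (h0 : p 0)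
    (hadd : ∀ a b, p a → p b → p (a + b)) (hcons : ∀ x t, p (cons x t)) (v) : p v := by
  obtain ⟨w, rfl⟩ := (preSucc G n).symm.surjective v
  induction w with
  | zero => rw [map_zero]; exact h0
  | tmul x t => exact hcons x t
  | add a b ha hb => rw [map_add]; exact hadd _ _ ha hb

theorem ext_cons {n : ℕ} {F : Type*} [AddCommGroup F] [Module ℂ F] [TopologicalSpace F]
    {S T : PreTensor G (n + 1) →L[ℂ] F}
    (h : ∀ (x : G) (t : PreTensor G n), S (cons x t) = T (cons x t)) : S = T :=
  preTensor_ext h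

theorem ext_cons_cons {n : ℕ} {F : Type*} [AddCommGroup F] [Module ℂ F] [TopologicalSpace F]
    {S T : PreTensor G (n + 2) →L[ℂ] F}
    (h : ∀ (x y : G) (t : PreTensor G n), S (cons x (cons y t)) = T (cons x (cons y t))) :
    S = T := by
  refine ext_cons fun x v => ?_
  induction v using cons_induction with
  | h0 => rw [cons_zero, map_zero, map_zero]
  | hadd a b ha hb => rw [cons_add, map_add, map_add, ha, hb]
  | hcons y t => exact h x y t

theorem ext_zero {F : Type*} [AddCommGroup F] [Module ℂ F] [TopologicalSpace F]
    {S T : PreTensor G 0 →L[ℂ] F} (h : ∀ t, S t = T t) : S = T :=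
  ContinuousLinearMap.ext h

theorem insertAlt_zero (f : G) (t : PreTensor G 0) : insertAlt f 0 t = cons f t := rfl

theorem insertAlt_cons (f x : G) {n : ℕ} (t : PreTensor G n) :
    insertAlt f (n + 1) (cons x t) = cons f (cons x t) - cons x (insertAlt f n t) := rfl

theorem preDGamma_cons (B : G →L[ℂ] G) (x : G) {n : ℕ} (t : PreTensor G n) :
    preDGamma B (n + 1) (cons x t) = cons (B x) t + cons x (preDGamma B n t) := rfl

theorem preDGamma_zero_apply (B : G →L[ℂ] G) (t : PreTensor G 0) : preDGamma B 0 t = 0 := rfl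

/-- The canonical anticommutation relation between contraction and insertion, on the vacuum. -/
theorem contract_comp_insertAlt_zero (f g : G) :
    contract g 0 ∘L insertAlt f 0 = ⟪g, f⟫_ℂ • ContinuousLinearMap.id ℂ (PreTensor G 0) := rfl

/-- The canonical anticommutation relation between contraction and insertion. It holds on the whole
tensor power, not only on antisymmetric tensors. -/
theorem contract_comp_insertAlt_succ (f g : G) (n : ℕ) :
    contract g (n + 1) ∘L insertAlt f (n + 1) + insertAlt f n ∘L contract g n =
      ⟪g, f⟫_ℂ • ContinuousLinearMap.id ℂ (PreTensor G (n + 1)) := by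
  refine ext_cons fun x t => ?_
  change contract g (n + 1) (insertAlt f (n + 1) (cons x t)) +
    insertAlt f n (contract g n (cons x t)) = ⟪g, f⟫_ℂ • cons x t
  rw [insertAlt_cons, map_sub, contract_cons, contract_cons, contract_cons, map_smul,
    sub_add_cancel]

/-- Alternating insertions anticommute on the whole tensor power. -/
theorem insertAlt_comp_insertAlt (f g : G) (n : ℕ) :
    insertAlt f (n + 1) ∘L insertAlt g n = -(insertAlt g (n + 1) ∘L insertAlt f n) := by
  induction n with
  | zero =>
    refine ext_zero fun t => ?_
    change insertAlt f 1 (insertAlt g 0 t) = -insertAlt g 1 (insertAlt f 0 t)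
    simp only [insertAlt_zero, insertAlt_cons, neg_sub]
  | succ n ih =>
    refine ext_cons fun x t => ?_
    have h : insertAlt f (n + 1) (insertAlt g n t) = -insertAlt g (n + 1) (insertAlt f n t) :=
      DFunLike.congr_fun ih t
    change insertAlt f (n + 2) (insertAlt g (n + 1) (cons x t)) =
      -insertAlt g (n + 2) (insertAlt f (n + 1) (cons x t))
    simp only [insertAlt_cons, map_sub, h, cons_sub, cons_neg]
    abel

theorem contract_comp_preDGamma (B : G →L[ℂ] G) [CompleteSpace G] (f : G) (n : ℕ) :
    contract f n ∘L preDGamma B (n + 1) =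
      preDGamma B n ∘L contract f n + contract (ContinuousLinearMap.adjoint B f) n := by
  refine ext_cons fun x t => ?_
  change contract f n (preDGamma B (n + 1) (cons x t)) =
    preDGamma B n (contract f n (cons x t)) + contract (ContinuousLinearMap.adjoint B f) n (cons x t)
  simp only [preDGamma_cons, map_add, contract_cons, map_smul,
    ContinuousLinearMap.adjoint_inner_left]
  abel

theorem preDGamma_comp_insertAlt (B : G →L[ℂ] G) (f : G) (n : ℕ) :
    preDGamma B (n + 1) ∘L insertAlt f n =
      insertAlt f n ∘L preDGamma B n + insertAlt (B f) n := by
  induction n with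
  | zero =>
    refine ext_zero fun t => ?_
    change preDGamma B 1 (insertAlt f 0 t) = insertAlt f 0 (preDGamma B 0 t) + insertAlt (B f) 0 t
    simp only [insertAlt_zero, preDGamma_cons, preDGamma_zero_apply, map_zero, cons_zero,
      add_zero, zero_add]
  | succ n ih =>
    refine ext_cons fun x t => ?_
    have h : preDGamma B (n + 1) (insertAlt f n t) =
      insertAlt f n (preDGamma B n t) + insertAlt (B f) n t := DFunLike.congr_fun ih t
    change preDGamma B (n + 2) (insertAlt f (n + 1) (cons x t)) =
      insertAlt f (n + 1) (preDGamma B (n + 1) (cons x t)) + insertAlt (B f) (n + 1) (cons x t)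
    simp only [insertAlt_cons, preDGamma_cons, map_add, map_sub, h, cons_add]
    abel

theorem preDGamma_commutator (B D : G →L[ℂ] G) (n : ℕ) :
    preDGamma B n ∘L preDGamma D n =
      preDGamma D n ∘L preDGamma B n + preDGamma (B * D - D * B) n := by
  induction n with
  | zero => simp [preDGamma]
  | succ n ih =>
    refine ext_cons fun x t => ?_
    have h : preDGamma B n (preDGamma D n t) =
      preDGamma D n (preDGamma B n t) + preDGamma (B * D - D * B) n t := DFunLike.congr_fun ih t
    change preDGamma B (n + 1) (preDGamma D (n + 1) (cons x t)) =
      preDGamma D (n + 1) (preDGamma B (n + 1) (cons x t)) +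
        preDGamma (B * D - D * B) (n + 1) (cons x t)
    have hBD : (B * D - D * B) x = B (D x) + -D (B x) := sub_eq_add_neg _ _
    have hneg : ∀ y : G, cons (-y) t = -cons y t := fun y => by
      rw [← neg_one_smul ℂ y, cons_smul_left, neg_one_smul]
    simp only [preDGamma_cons, map_add, h, cons_add, hBD, cons_add_left, hneg]
    abel

/-! ### Insertion and antisymmetric tensors -/

theorem oneTensor_add {m n : ℕ} (S T : PreTensor G m →L[ℂ] PreTensor G n) :
    oneTensor (S + T) = oneTensor S + oneTensor T :=
  ext_cons fun x t => cons_add x (S t) (T t)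

theorem oneTensor_smul {m n : ℕ} (c : ℂ) (S : PreTensor G m →L[ℂ] PreTensor G n) :
    oneTensor (c • S) = c • oneTensor S :=
  ext_cons fun x t => cons_smul c x (S t)

/-- `S ↦ 𝟏 ⊗ S` as a linear map. -/
def oneTensorₗ (m n : ℕ) : (PreTensor G m →L[ℂ] PreTensor G n) →ₗ[ℂ]
    (PreTensor G (m + 1) →L[ℂ] PreTensor G (n + 1)) where
  toFun := oneTensor
  map_add' := oneTensor_add
  map_smul' := oneTensor_smul

theorem idTensor_mem_adjacentSwaps {n : ℕ} {S : PreTensor G n →L[ℂ] PreTensor G n}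
    (hS : S ∈ adjacentSwaps G n) : idTensor S ∈ adjacentSwaps G (n + 1) := by
  cases n with
  | zero => exact hS.elim
  | succ n => exact Set.mem_insert_of_mem _ ⟨S, hS, rfl⟩

variable (G) in
/-- The span of the operators `D (𝟏 + S)`, with `S` an exchange of neighbouring factors: they vanish
on antisymmetric tensors. -/
def swapRight (m n : ℕ) : Submodule ℂ (PreTensor G m →L[ℂ] PreTensor G n) :=
  Submodule.span ℂ {Z | ∃ S ∈ adjacentSwaps G m, ∃ D, Z = D + D ∘L S}

variable (G) in
/-- The span of the operators `(𝟏 + S) D`, with `S` an exchange of neighbouring factors: their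
ranges are orthogonal to antisymmetric tensors. -/
def swapLeft (m n : ℕ) : Submodule ℂ (PreTensor G m →L[ℂ] PreTensor G n) :=
  Submodule.span ℂ {Z | ∃ S ∈ adjacentSwaps G n, ∃ D, Z = D + S ∘L D}

theorem oneTensor_mem_swapRight {m n : ℕ} {Z : PreTensor G m →L[ℂ] PreTensor G n}
    (hZ : Z ∈ swapRight G m n) : oneTensor Z ∈ swapRight G (m + 1) (n + 1) := by
  have : swapRight G m n ≤ (swapRight G (m + 1) (n + 1)).comap (oneTensorₗ m n) := by
    refine Submodule.span_le.2 ?_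
    rintro _ ⟨S, hS, D, rfl⟩
    exact Submodule.subset_span ⟨idTensor S, idTensor_mem_adjacentSwaps hS, oneTensor D,
      (oneTensor_add _ _).trans (congrArg _ (ext_cons fun _ _ => rfl))⟩
  exact this hZ

theorem oneTensor_mem_swapLeft {m n : ℕ} {Z : PreTensor G m →L[ℂ] PreTensor G n}
    (hZ : Z ∈ swapLeft G m n) : oneTensor Z ∈ swapLeft G (m + 1) (n + 1) := by
  have : swapLeft G m n ≤ (swapLeft G (m + 1) (n + 1)).comap (oneTensorₗ m n) := by
    refine Submodule.span_le.2 ?_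
    rintro _ ⟨S, hS, D, rfl⟩
    exact Submodule.subset_span ⟨idTensor S, idTensor_mem_adjacentSwaps hS, oneTensor D,
      (oneTensor_add _ _).trans (congrArg _ (ext_cons fun _ _ => rfl))⟩
  exact this hZ

/-- Alternating insertion maps antisymmetric tensors to antisymmetric tensors. -/
theorem insertAlt_add_swap_mem (f : G) (n : ℕ) :
    ∀ S ∈ adjacentSwaps G (n + 1), insertAlt f n + S ∘L insertAlt f n ∈ swapRight G n (n + 1) := by
  induction n with
  | zero => intro S hS; exact hS.elim
  | succ n ih =>
    rintro S (rfl | ⟨S, hS, rfl⟩)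
    · cases n with
      | zero =>
        convert Submodule.zero_mem _
        refine ext_cons fun x t => ?_
        change insertAlt f 1 (cons x t) + swapFirst G 0 (insertAlt f 1 (cons x t)) = 0
        rw [insertAlt_cons, map_sub, insertAlt_zero, swapFirst_cons, swapFirst_cons]
        abel
      | succ n =>
        refine Submodule.subset_span ⟨_, Set.mem_insert _ _, oneTensor (oneTensor (insertAlt f n)), ?_⟩
        refine ext_cons_cons fun x y t => ?_
        change insertAlt f (n + 2) (cons x (cons y t)) +
          swapFirst G (n + 1) (insertAlt f (n + 2) (cons x (cons y t))) =
          cons x (cons y (insertAlt f n t)) + cons y (cons x (insertAlt f n t))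
        simp only [insertAlt_cons, map_sub, swapFirst_cons, cons_sub]
        abel
    · have h : insertAlt f (n + 1) + idTensor S ∘L insertAlt f (n + 1) =
          (consL f (n + 1) + consL f (n + 1) ∘L S) -
            oneTensor (insertAlt f n + S ∘L insertAlt f n) := by
        refine ext_cons fun x t => ?_
        change insertAlt f (n + 1) (cons x t) + idTensor S (insertAlt f (n + 1) (cons x t)) =
          (cons f (cons x t) + cons f (S (cons x t))) -
            cons x (insertAlt f n t + S (insertAlt f n t))
        rw [insertAlt_cons, map_sub, idTensor_cons, idTensor_cons, cons_add]
        abel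
      rw [h]
      exact Submodule.sub_mem _ (Submodule.subset_span ⟨S, hS, _, rfl⟩)
        (oneTensor_mem_swapRight (ih S hS))

/-- The alternating insertion and `n + 1` times the insertion in the first place have the same
antisymmetrization. -/
theorem insertAlt_sub_consL_mem (f : G) (n : ℕ) :
    insertAlt f n - ((n : ℂ) + 1) • consL f n ∈ swapLeft G n (n + 1) := by
  induction n with
  | zero =>
    convert Submodule.zero_mem _
    simp [insertAlt]
  | succ n ih =>
    have h : insertAlt f (n + 1) - (((n + 1 : ℕ) : ℂ) + 1) • consL f (n + 1) =
        -oneTensor (insertAlt f n - ((n : ℂ) + 1) • consL f n) - ((n : ℂ) + 1) •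
          (consL f (n + 1) +
            (swapFirst G n).toContinuousLinearEquiv.toContinuousLinearMap ∘L consL f (n + 1)) := by
      refine ext_cons fun x t => ?_
      change insertAlt f (n + 1) (cons x t) - (((n + 1 : ℕ) : ℂ) + 1) • cons f (cons x t) =
        -cons x (insertAlt f n t - ((n : ℂ) + 1) • cons f t) - ((n : ℂ) + 1) •
          (cons f (cons x t) + cons x (cons f t))
      rw [insertAlt_cons, cons_sub, cons_smul]
      push_cast
      module
    rw [h]
    refine Submodule.sub_mem _ (Submodule.neg_mem _ (oneTensor_mem_swapLeft ih))
      (Submodule.smul_mem _ _ (Submodule.subset_span ⟨_, Set.mem_insert _ _, _, rfl⟩))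

end Creation

section FockOperators

variable {G : Type u} [NormedAddCommGroup G] [InnerProductSpace ℂ G]

/-! ### Completed tensor powers -/

theorem completion_comp {E F F' : Type*} [NormedAddCommGroup E] [NormedSpace ℂ E]
    [NormedAddCommGroup F] [NormedSpace ℂ F] [NormedAddCommGroup F'] [NormedSpace ℂ F']
    (S : F →L[ℂ] F') (T : E →L[ℂ] F) : (S ∘L T).completion = S.completion ∘L T.completion := by
  ext t
  induction t using Completion.induction_on with
  | hp => exact isClosed_eq (by fun_prop) (by fun_prop)
  | ih t => simp

theorem completion_id (E : Type*) [NormedAddCommGroup E] [NormedSpace ℂ E] :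
    (ContinuousLinearMap.id ℂ E).completion = ContinuousLinearMap.id ℂ (Completion E) := by
  ext t
  induction t using Completion.induction_on with
  | hp => exact isClosed_eq (by fun_prop) (by fun_prop)
  | ih t => simp

theorem completion_zero {E F : Type*} [NormedAddCommGroup E] [NormedSpace ℂ E]
    [NormedAddCommGroup F] [NormedSpace ℂ F] : (0 : E →L[ℂ] F).completion = 0 := by
  have h := completion_smul (0 : ℂ) (0 : E →L[ℂ] F)
  rwa [zero_smul, zero_smul] at h

theorem completion_neg {E F : Type*} [NormedAddCommGroup E] [NormedSpace ℂ E]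
    [NormedAddCommGroup F] [NormedSpace ℂ F] (S : E →L[ℂ] F) :
    (-S).completion = -S.completion := by
  rw [← neg_one_smul ℂ, completion_smul, neg_one_smul]

theorem completion_sub {E F : Type*} [NormedAddCommGroup E] [NormedSpace ℂ E]
    [NormedAddCommGroup F] [NormedSpace ℂ F] (S T : E →L[ℂ] F) :
    (S - T).completion = S.completion - T.completion := by
  rw [sub_eq_add_neg, completion_add, completion_neg, sub_eq_add_neg]

theorem norm_completion_le {E F : Type*} [NormedAddCommGroup E] [NormedSpace ℂ E]
    [NormedAddCommGroup F] [NormedSpace ℂ F] (S : E →L[ℂ] F) : ‖S.completion‖ ≤ ‖S‖ := by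
  refine ContinuousLinearMap.opNorm_le_bound _ (norm_nonneg _) fun t => ?_
  induction t using Completion.induction_on with
  | hp => exact isClosed_le (by fun_prop) (by fun_prop)
  | ih t =>
    rw [ContinuousLinearMap.completion_apply_coe, Completion.norm_coe, Completion.norm_coe]
    exact S.le_opNorm t

theorem continuous_completion {E F : Type*} [NormedAddCommGroup E] [NormedSpace ℂ E]
    [NormedAddCommGroup F] [NormedSpace ℂ F] :
    Continuous (fun S : E →L[ℂ] F => S.completion) := by
  refine LipschitzWith.continuous (K := 1) (LipschitzWith.of_dist_le_mul fun S T => ?_)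
  rw [dist_eq_norm, dist_eq_norm, ← completion_sub, NNReal.coe_one, one_mul]
  exact norm_completion_le _

/-- Identities between inner products of bounded operators extend to completions. -/
theorem inner_completion_eq {E F : Type*} [NormedAddCommGroup E] [InnerProductSpace ℂ E]
    [NormedAddCommGroup F] [InnerProductSpace ℂ F] {S : E →L[ℂ] F} {T : F →L[ℂ] E}
    (h : ∀ x y, ⟪S x, y⟫_ℂ = ⟪x, T y⟫_ℂ) (x : Completion E) (y : Completion F) :
    ⟪S.completion x, y⟫_ℂ = ⟪x, T.completion y⟫_ℂ := by
  induction x, y using Completion.induction_on₂ with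
  | hp => exact isClosed_eq (by fun_prop) (by fun_prop)
  | ih x y =>
    rw [ContinuousLinearMap.completion_apply_coe, ContinuousLinearMap.completion_apply_coe,
      Completion.inner_coe, Completion.inner_coe, h]

theorem inner_swapFirst {n : ℕ} (v w : PreTensor G (n + 2)) :
    ⟪swapFirst G n v, w⟫_ℂ = ⟪v, swapFirst G n w⟫_ℂ := by
  have h : ∀ w, swapFirst G n (swapFirst G n w) = w := by
    intro w
    have : (swapFirst G n).toContinuousLinearEquiv.toContinuousLinearMap ∘L
        (swapFirst G n).toContinuousLinearEquiv.toContinuousLinearMap =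
        ContinuousLinearMap.id ℂ (PreTensor G (n + 2)) :=
      ext_cons_cons fun x y t => rfl
    exact DFunLike.congr_fun this w
  rw [← (swapFirst G n).inner_map_map v, h]

theorem inner_oneTensor {m n : ℕ} {S : PreTensor G m →L[ℂ] PreTensor G n}
    {T : PreTensor G n →L[ℂ] PreTensor G m} (h : ∀ x y, ⟪S x, y⟫_ℂ = ⟪x, T y⟫_ℂ)
    (v : PreTensor G (m + 1)) (w : PreTensor G (n + 1)) :
    ⟪oneTensor S v, w⟫_ℂ = ⟪v, oneTensor T w⟫_ℂ := by
  induction v using cons_induction with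
  | h0 => simp
  | hadd a b ha hb => rw [map_add, inner_add_left, inner_add_left, ha, hb]
  | hcons x s =>
    induction w using cons_induction with
    | h0 => simp
    | hadd a b ha hb => rw [map_add, inner_add_right, inner_add_right, ha, hb]
    | hcons y t => rw [oneTensor_cons, oneTensor_cons, inner_cons, inner_cons, h]

theorem inner_adjacentSwaps {n : ℕ} : ∀ S ∈ adjacentSwaps G n, ∀ v w : PreTensor G n,
    ⟪S v, w⟫_ℂ = ⟪v, S w⟫_ℂ := by
  induction n with
  | zero => intro S hS; exact hS.elim
  | succ n ih =>
    cases n with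
    | zero => intro S hS; exact hS.elim
    | succ n =>
      rintro S (rfl | ⟨S, hS, rfl⟩)
      · exact inner_swapFirst
      · exact inner_oneTensor (ih S hS)

theorem completion_apply_eq_zero_of_mem_swapRight {m n : ℕ}
    {Z : PreTensor G m →L[ℂ] PreTensor G n} (hZ : Z ∈ swapRight G m n) {v : HTensor G m}
    (hv : v ∈ antisymm G m) : Z.completion v = 0 := by
  induction hZ using Submodule.span_induction with
  | mem Z h =>
    obtain ⟨S, hS, D, rfl⟩ := h
    rw [completion_add, completion_comp, add_apply, ContinuousLinearMap.comp_apply, hv S hS,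
      map_neg, add_neg_cancel]
  | zero => rw [completion_zero, zero_apply]
  | add A B _ _ hA hB => rw [completion_add, add_apply, hA, hB, add_zero]
  | smul c A _ hA => rw [completion_smul, smul_apply, hA, smul_zero]

theorem inner_completion_eq_zero_of_mem_swapLeft {m n : ℕ}
    {Z : PreTensor G m →L[ℂ] PreTensor G n} (hZ : Z ∈ swapLeft G m n) {s : HTensor G n}
    (hs : s ∈ antisymm G n) (v : HTensor G m) : ⟪s, Z.completion v⟫_ℂ = 0 := by
  induction hZ using Submodule.span_induction with
  | mem Z h =>
    obtain ⟨S, hS, D, rfl⟩ := h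
    rw [completion_add, completion_comp, add_apply, ContinuousLinearMap.comp_apply,
      inner_add_right, ← inner_completion_eq (inner_adjacentSwaps S hS), hs S hS, inner_neg_left,
      add_neg_cancel]
  | zero => rw [completion_zero, zero_apply, inner_zero_right]
  | add A B _ _ hA hB => rw [completion_add, add_apply, inner_add_right, hA, hB, add_zero]
  | smul c A _ hA => rw [completion_smul, smul_apply, inner_smul_right, hA, mul_zero]

theorem inner_antisymmetrizer {n : ℕ} (s : antisymm G n) (v : HTensor G n) :
    ⟪s, antisymmetrizer G n v⟫_ℂ = ⟪(s : HTensor G n), v⟫_ℂ :=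
  (antisymm G n).inner_orthogonalProjectionOnto_eq_of_mem_left s v

theorem insertAlt_mem (f : G) {n : ℕ} (t : antisymm G n) :
    (insertAlt f n).completion t ∈ antisymm G (n + 1) := by
  intro S hS
  have h := completion_apply_eq_zero_of_mem_swapRight (insertAlt_add_swap_mem f n S hS) t.2
  rw [completion_add, completion_comp] at h
  exact eq_neg_of_add_eq_zero_right h

theorem contract_mem (f : G) {n : ℕ} (t : antisymm G (n + 1)) :
    (contract f n).completion t ∈ antisymm G n := by
  intro S hS
  have h : S ∘L contract f n = contract f n ∘L idTensor S :=
    ext_cons fun x t => map_smul S _ _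
  have h' := congrArg (fun Z => Z.completion (t : HTensor G (n + 1))) h
  simp only [completion_comp, ContinuousLinearMap.comp_apply] at h'
  rw [h', t.2 _ (idTensor_mem_adjacentSwaps hS), map_neg]

/-- The operator `g⁽ⁿ⁾ ↦ 𝒜ₙ₊₁(f ⊗ g⁽ⁿ⁾)`, expressed by the alternating insertion. -/
theorem antisymmetrizer_consL (f : G) {n : ℕ} (t : antisymm G n) :
    ((n : ℂ) + 1) • (antisymmetrizer G (n + 1) ((consL f n).completion t) : HTensor G (n + 1)) =
      (insertAlt f n).completion t := by
  have h : antisymmetrizer G (n + 1) ((insertAlt f n).completion t) =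
      ((n : ℂ) + 1) • antisymmetrizer G (n + 1) ((consL f n).completion t) := by
    refine ext_inner_left ℂ fun s => ?_
    have h1 := inner_completion_eq_zero_of_mem_swapLeft (insertAlt_sub_consL_mem f n) s.2
      (t : HTensor G n)
    rw [completion_sub, completion_smul, sub_apply, inner_sub_right, sub_eq_zero] at h1
    rw [← map_smul, inner_antisymmetrizer, inner_antisymmetrizer, h1]
    rfl
  have h2 := congrArg (Subtype.val) h
  have h3 : antisymmetrizer G (n + 1) ((insertAlt f n).completion t) =
      ⟨(insertAlt f n).completion t, insertAlt_mem f t⟩ :=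
    (antisymm G (n + 1)).orthogonalProjectionOnto_mem_subspace_eq_self
      ⟨(insertAlt f n).completion t, insertAlt_mem f t⟩
  rw [h3] at h2
  exact h2.symm

theorem inner_contract (f : G) {n : ℕ} (v : PreTensor G (n + 1)) (w : PreTensor G n) :
    ⟪contract f n v, w⟫_ℂ = ⟪v, consL f n w⟫_ℂ := by
  induction v using cons_induction with
  | h0 => simp
  | hadd a b ha hb => rw [map_add, inner_add_left, inner_add_left, ha, hb]
  | hcons x s => rw [contract_cons, consL_apply, inner_cons, inner_smul_left, inner_conj_symm]

theorem contract_comp_contract {f g : G} {n : ℕ} (t : antisymm G (n + 2)) :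
    (contract f n).completion ((contract g (n + 1)).completion t) =
      -(contract g n).completion ((contract f (n + 1)).completion t) := by
  have h : contract f n ∘L contract g (n + 1) = (contract g n ∘L contract f (n + 1)) ∘L
      (swapFirst G n).toContinuousLinearEquiv.toContinuousLinearMap := by
    refine ext_cons_cons fun x y t => ?_
    change contract f n (⟪g, x⟫_ℂ • cons y t) = contract g n (⟪f, y⟫_ℂ • cons x t)
    rw [map_smul, map_smul, contract_cons, contract_cons, smul_comm]
  have h' := congrArg (fun Z => Z.completion (t : HTensor G (n + 2))) h
  simp only [completion_comp, ContinuousLinearMap.comp_apply] at h'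
  rw [h', t.2 _ (Set.mem_insert _ _), map_neg, map_neg]

/-- A tensor all of whose contractions vanish is zero. -/
theorem eq_zero_of_contract_eq_zero {n : ℕ} {t : HTensor G (n + 1)}
    (h : ∀ f, (contract f n).completion t = 0) : t = 0 := by
  refine ext_inner_right ℂ fun v => ?_
  rw [inner_zero_left]
  induction v using Completion.induction_on with
  | hp => exact isClosed_eq (by fun_prop) (by fun_prop)
  | ih v =>
    induction v using cons_induction with
    | h0 => rw [Completion.coe_zero, inner_zero_right]
    | hadd a b ha hb => rw [Completion.coe_add, inner_add_right, ha, hb, add_zero]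
    | hcons x s =>
      rw [← consL_apply, ← ContinuousLinearMap.completion_apply_coe,
        ← inner_completion_eq (inner_contract x), h, inner_zero_left]

end FockOperators

section CAR

variable {G : Type u} [NormedAddCommGroup G] [InnerProductSpace ℂ G]

/-! ### Operators in the Fock space and their components -/

theorem lof_apply_self (n : ℕ) (x : antisymm G n) :
    DirectSum.lof ℂ ℕ (fun k => antisymm G k) n x n = x :=
  DirectSum.lof_apply (R := ℂ) (M := fun k => antisymm G k) n x

theorem lof_apply_of_ne {n m : ℕ} (x : antisymm G n) (h : m ≠ n) :
    DirectSum.lof ℂ ℕ (fun k => antisymm G k) n x m = 0 :=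
  DirectSum.of_eq_of_ne (β := fun k => antisymm G k) n m x h

theorem fockFin_induction {p : FockFin G → Prop} (g : FockFin G) (zero : p 0)
    (lof : ∀ n x, p (DirectSum.lof ℂ ℕ (fun k => antisymm G k) n x))
    (add : ∀ a b, p a → p b → p (a + b)) : p g :=
  DirectSum.induction_on g zero lof add

/-- Components of an operator in the Fock space that raises the number of particles by `k`. -/
theorem toModule_raise_apply (k : ℕ) (T : ∀ n, antisymm G n →ₗ[ℂ] antisymm G (n + k))
    (g : FockFin G) (m : ℕ) :
    DirectSum.toModule ℂ ℕ (FockFin G)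
      (fun n => DirectSum.lof ℂ ℕ (fun k => antisymm G k) (n + k) ∘ₗ T n) g (m + k) = T m (g m) := by
  induction g using fockFin_induction with
  | zero => rw [map_zero, DirectSum.zero_apply, DirectSum.zero_apply, map_zero]
  | add a b ha hb => rw [map_add, DirectSum.add_apply, DirectSum.add_apply, ha, hb, map_add]
  | lof n x =>
    rw [DirectSum.toModule_lof, LinearMap.comp_apply]
    by_cases h : m = n
    · subst h
      rw [lof_apply_self, lof_apply_self]
    · rw [lof_apply_of_ne _ h, lof_apply_of_ne _ (by omega), map_zero]

theorem toModule_raise_apply_of_lt (k : ℕ) (T : ∀ n, antisymm G n →ₗ[ℂ] antisymm G (n + k))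
    (g : FockFin G) {m : ℕ} (hm : m < k) :
    DirectSum.toModule ℂ ℕ (FockFin G)
      (fun n => DirectSum.lof ℂ ℕ (fun k => antisymm G k) (n + k) ∘ₗ T n) g m = 0 := by
  induction g using fockFin_induction with
  | zero => rw [map_zero, DirectSum.zero_apply]
  | add a b ha hb => rw [map_add, DirectSum.add_apply, ha, hb, add_zero]
  | lof n x =>
    rw [DirectSum.toModule_lof, LinearMap.comp_apply, lof_apply_of_ne _ (by omega)]

theorem create₂_apply_add_two (φ : Completion (G ⊗[ℂ] G)) (g : FockFin G) (m : ℕ) :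
    create₂ φ g (m + 2) = create₂Aux φ m (g m) :=
  toModule_raise_apply 2 (fun n => (create₂Aux φ n).toLinearMap) g m

theorem create₂_apply_of_lt (φ : Completion (G ⊗[ℂ] G)) (g : FockFin G) {m : ℕ} (hm : m < 2) :
    create₂ φ g m = 0 :=
  toModule_raise_apply_of_lt 2 (fun n => (create₂Aux φ n).toLinearMap) g hm

theorem coe_dGamma_apply (B : G →L[ℂ] G) (g : FockFin G) (m : ℕ) :
    (dGamma B g m : HTensor G m) = (preDGamma B m).completion (g m) :=
  congrArg Subtype.val (toModule_raise_apply 0 (fun n =>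
    (((preDGamma B n).completion ∘L (antisymm G n).subtypeL).codRestrict (antisymm G n)
        (preDGamma_mem B n)).toLinearMap) g m)

/-- The component `G^{∧(n+2)} → G^{∧n}` of `a⁻(φ)`. -/
def annihilate₂Component (φ : Completion (G ⊗[ℂ] G)) (n : ℕ) :
    antisymm G (n + 2) →ₗ[ℂ] antisymm G n :=
  ((((n : ℂ) + 2) * ((n : ℂ) + 1)) • (ContinuousLinearMap.adjoint (create₂Aux φ n))).toLinearMap

theorem annihilate₂_apply (φ : Completion (G ⊗[ℂ] G)) (g : FockFin G) (m : ℕ) :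
    annihilate₂ φ g m = annihilate₂Component φ m (g (m + 2)) := by
  induction g using fockFin_induction with
  | zero => rw [map_zero, DirectSum.zero_apply, DirectSum.zero_apply, map_zero]
  | add a b ha hb => rw [map_add, DirectSum.add_apply, DirectSum.add_apply, ha, hb, map_add]
  | lof n x =>
    rw [annihilate₂, DirectSum.toModule_lof]
    match n, x with
    | 0, x => rw [lof_apply_of_ne _ (by omega), map_zero]; rfl
    | 1, x => rw [lof_apply_of_ne _ (by omega), map_zero]; rfl
    | n + 2, x =>
      change DirectSum.lof ℂ ℕ (fun k => antisymm G k) n (annihilate₂Component φ n x) m = _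
      by_cases h : m = n
      · subst h
        rw [lof_apply_self, lof_apply_self]
      · rw [lof_apply_of_ne _ h, lof_apply_of_ne _ (by omega), map_zero]

/-- The one-particle creation operator: `a⁺(f) g⁽ⁿ⁾ = 𝒜ₙ₊₁(f ⊗ g⁽ⁿ⁾)`. -/
def create₁ (f : G) : Module.End ℂ (FockFin G) :=
  DirectSum.toModule ℂ ℕ (FockFin G) fun n =>
    DirectSum.lof ℂ ℕ (fun k => antisymm G k) (n + 1) ∘ₗ
      (antisymmetrizer G (n + 1) ∘L (consL f n).completion ∘L (antisymm G n).subtypeL).toLinearMap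

/-- The components of the one-particle annihilation operator. -/
def annihilate₁Aux (f : G) : ∀ n : ℕ, antisymm G n →ₗ[ℂ] FockFin G
  | 0 => 0
  | n + 1 => DirectSum.lof ℂ ℕ (fun k => antisymm G k) n ∘ₗ (((n : ℂ) + 1) •
      (((contract f n).completion ∘L (antisymm G (n + 1)).subtypeL).codRestrict (antisymm G n)
        (contract_mem f)).toLinearMap)

/-- The one-particle annihilation operator: on `G^{∧n}` it is `n` times the contraction with `f`, the
factor `n` coming from the weights `n!` in the inner product of the Fock space. -/
def annihilate₁ (f : G) : Module.End ℂ (FockFin G) :=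
  DirectSum.toModule ℂ ℕ (FockFin G) (annihilate₁Aux f)

theorem create₁_apply_succ (f : G) (g : FockFin G) (m : ℕ) :
    create₁ f g (m + 1) = antisymmetrizer G (m + 1) ((consL f m).completion (g m)) :=
  toModule_raise_apply 1 (fun n => (antisymmetrizer G (n + 1) ∘L (consL f n).completion ∘L
    (antisymm G n).subtypeL).toLinearMap) g m

theorem create₁_apply_zero (f : G) (g : FockFin G) : create₁ f g 0 = 0 :=
  toModule_raise_apply_of_lt 1 (fun n => (antisymmetrizer G (n + 1) ∘L (consL f n).completion ∘L
    (antisymm G n).subtypeL).toLinearMap) g Nat.one_pos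

theorem coe_create₁_apply_succ (f : G) (g : FockFin G) (m : ℕ) :
    (create₁ f g (m + 1) : HTensor G (m + 1)) =
      ((m : ℂ) + 1)⁻¹ • (insertAlt f m).completion (g m) := by
  rw [create₁_apply_succ, ← antisymmetrizer_consL, inv_smul_smul₀ (Nat.cast_add_one_ne_zero m)]

theorem coe_annihilate₁_apply (f : G) (g : FockFin G) (m : ℕ) :
    (annihilate₁ f g m : HTensor G m) = ((m : ℂ) + 1) • (contract f m).completion (g (m + 1)) := by
  induction g using fockFin_induction with
  | zero => simp
  | add a b ha hb =>
    rw [map_add, DirectSum.add_apply, DirectSum.add_apply, Submodule.coe_add, Submodule.coe_add, ha,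
      hb, map_add, smul_add]
  | lof n x =>
    rw [annihilate₁, DirectSum.toModule_lof]
    match n, x with
    | 0, x => rw [lof_apply_of_ne _ (by omega), Submodule.coe_zero, map_zero, smul_zero]; rfl
    | n + 1, x =>
      change ((DirectSum.lof ℂ ℕ (fun k => antisymm G k) n (((n : ℂ) + 1) •
        (⟨(contract f n).completion x, contract_mem f x⟩ : antisymm G n)) m : antisymm G m) :
          HTensor G m) = _
      by_cases h : m = n
      · subst h
        rw [lof_apply_self, lof_apply_self]
        rfl
      · rw [lof_apply_of_ne _ h, lof_apply_of_ne _ (by omega), Submodule.coe_zero,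
          Submodule.coe_zero, map_zero, smul_zero]

theorem end_ext {F F' : Module.End ℂ (FockFin G)}
    (h : ∀ g m, (F g m : HTensor G m) = (F' g m : HTensor G m)) : F = F' :=
  LinearMap.ext fun g => DFinsupp.ext fun m => Subtype.ext (h g m)

theorem coe_add_apply (f g : FockFin G) (m : ℕ) :
    ((f + g) m : HTensor G m) = (f m : HTensor G m) + g m := rfl

theorem coe_sub_apply (f g : FockFin G) (m : ℕ) :
    ((f - g) m : HTensor G m) = (f m : HTensor G m) - g m := rfl

theorem coe_neg_apply (f : FockFin G) (m : ℕ) :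
    ((-f) m : HTensor G m) = -(f m : HTensor G m) := rfl

theorem coe_smul_apply (c : ℂ) (f : FockFin G) (m : ℕ) :
    ((c • f) m : HTensor G m) = c • (f m : HTensor G m) := rfl

/-- The following three rules restate `mul_sub`, `sub_mul` and `mul_neg` in a form that rewrites in
the endomorphism ring of `FockFin G`, whose subtraction is not found there by unification. -/
theorem end_mul_sub (A B C : Module.End ℂ (FockFin G)) : A * (B - C) = A * B - A * C :=
  mul_sub A B C

theorem end_sub_mul (A B C : Module.End ℂ (FockFin G)) : (A - B) * C = A * C - B * C :=
  sub_mul A B C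

theorem end_mul_neg (A B : Module.End ℂ (FockFin G)) : A * (-B) = -(A * B) :=
  LinearMap.ext fun g => map_neg A (B g)

/-! ### Canonical anticommutation relations -/

theorem annihilate₁_mul_create₁ (f g : G) :
    annihilate₁ f * create₁ g = ⟪f, g⟫_ℂ • 1 - create₁ g * annihilate₁ f := by
  refine end_ext fun v m => ?_
  rw [Module.End.mul_apply, LinearMap.sub_apply, LinearMap.smul_apply, Module.End.one_apply,
    Module.End.mul_apply, coe_sub_apply, coe_smul_apply, coe_annihilate₁_apply,
    coe_create₁_apply_succ, map_smul, smul_inv_smul₀ (Nat.cast_add_one_ne_zero m)]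
  cases m with
  | zero =>
    have h := congrArg (fun Z => Z.completion (v 0 : HTensor G 0)) (contract_comp_insertAlt_zero g f)
    simp only [completion_comp, completion_smul, completion_id] at h
    rw [create₁_apply_zero, Submodule.coe_zero, sub_zero]
    exact h
  | succ m =>
    have h := congrArg (fun Z => Z.completion (v (m + 1) : HTensor G (m + 1)))
      (contract_comp_insertAlt_succ g f m)
    simp only [completion_comp, completion_smul, completion_id, completion_add] at h
    rw [coe_create₁_apply_succ, coe_annihilate₁_apply, map_smul,
      inv_smul_smul₀ (Nat.cast_add_one_ne_zero m)]
    exact eq_sub_of_add_eq h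

theorem create₁_mul_create₁ (f g : G) : create₁ f * create₁ g = -(create₁ g * create₁ f) := by
  refine end_ext fun v m => ?_
  rw [LinearMap.neg_apply, coe_neg_apply, Module.End.mul_apply, Module.End.mul_apply]
  match m with
  | 0 => rw [create₁_apply_zero, create₁_apply_zero, Submodule.coe_zero, neg_zero]
  | 1 =>
    rw [coe_create₁_apply_succ, coe_create₁_apply_succ, create₁_apply_zero, create₁_apply_zero]
    simp
  | m + 2 =>
    have h := congrArg (fun Z => Z.completion (v m : HTensor G m)) (insertAlt_comp_insertAlt f g m)
    simp only [completion_comp, completion_neg] at h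
    rw [coe_create₁_apply_succ, coe_create₁_apply_succ, coe_create₁_apply_succ,
      coe_create₁_apply_succ, map_smul, map_smul, ← smul_neg, ← smul_neg]
    exact congrArg (fun z => (((m + 1 : ℕ) : ℂ) + 1)⁻¹ • ((m : ℂ) + 1)⁻¹ • z) h

theorem annihilate₁_mul_annihilate₁ (f g : G) :
    annihilate₁ f * annihilate₁ g = -(annihilate₁ g * annihilate₁ f) := by
  refine end_ext fun v m => ?_
  rw [LinearMap.neg_apply, coe_neg_apply, Module.End.mul_apply, Module.End.mul_apply]
  simp only [coe_annihilate₁_apply, map_smul]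
  rw [contract_comp_contract, smul_neg, smul_neg]

theorem annihilate₁_mul_dGamma [CompleteSpace G] (B : G →L[ℂ] G) (f : G) :
    annihilate₁ f * dGamma B =
      dGamma B * annihilate₁ f + annihilate₁ (ContinuousLinearMap.adjoint B f) := by
  refine end_ext fun v m => ?_
  have h := congrArg (fun Z => Z.completion (v (m + 1) : HTensor G (m + 1)))
    (contract_comp_preDGamma B f m)
  simp only [completion_comp, completion_add] at h
  rw [LinearMap.add_apply, coe_add_apply, Module.End.mul_apply, Module.End.mul_apply,
    coe_annihilate₁_apply, coe_annihilate₁_apply, coe_dGamma_apply, coe_dGamma_apply,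
    coe_annihilate₁_apply, map_smul, ← smul_add]
  exact congrArg _ h

theorem dGamma_mul_create₁ (B : G →L[ℂ] G) (f : G) :
    dGamma B * create₁ f = create₁ f * dGamma B + create₁ (B f) := by
  refine end_ext fun v m => ?_
  rw [LinearMap.add_apply, coe_add_apply, Module.End.mul_apply, Module.End.mul_apply,
    coe_dGamma_apply]
  cases m with
  | zero => simp [create₁_apply_zero]
  | succ m =>
    have h := congrArg (fun Z => Z.completion (v m : HTensor G m)) (preDGamma_comp_insertAlt B f m)
    simp only [completion_comp, completion_add] at h
    rw [coe_create₁_apply_succ, coe_create₁_apply_succ, coe_create₁_apply_succ, coe_dGamma_apply,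
      map_smul, ← smul_add]
    exact congrArg _ h

theorem dGamma_mul_dGamma (B D : G →L[ℂ] G) :
    dGamma B * dGamma D = dGamma D * dGamma B + dGamma (B * D - D * B) := by
  refine end_ext fun v m => ?_
  have h := congrArg (fun Z => Z.completion (v m : HTensor G m)) (preDGamma_commutator B D m)
  simp only [completion_comp, completion_add] at h
  rw [LinearMap.add_apply, coe_add_apply, Module.End.mul_apply, Module.End.mul_apply]
  simp only [coe_dGamma_apply]
  exact h

/-- An operator that commutes with all annihilation operators and vanishes on the vacuum component
is zero. -/
theorem eq_zero_of_commute_annihilate₁ {Y : Module.End ℂ (FockFin G)}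
    (hvac : ∀ g, Y g 0 = 0) (h : ∀ f, Commute (annihilate₁ f) Y) : Y = 0 := by
  have key : ∀ m g, Y g m = 0 := by
    intro m
    induction m with
    | zero => exact hvac
    | succ m ih =>
      intro g
      refine Subtype.ext (eq_zero_of_contract_eq_zero fun f => ?_)
      have h1 : annihilate₁ f (Y g) = Y (annihilate₁ f g) := DFunLike.congr_fun (h f).eq g
      have h2 := coe_annihilate₁_apply f (Y g) m
      rw [h1, ih, Submodule.coe_zero] at h2
      exact (smul_eq_zero.1 h2.symm).resolve_left (Nat.cast_add_one_ne_zero m)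
  exact LinearMap.ext fun g => DFinsupp.ext fun m => key m g

theorem annihilate₁_smul (c : ℂ) (x : G) :
    annihilate₁ (c • x) = starRingEnd ℂ c • annihilate₁ x := by
  refine end_ext fun v m => ?_
  have h : contract (c • x) m = starRingEnd ℂ c • contract x m := by
    refine ext_cons fun y t => ?_
    change contract (c • x) m (cons y t) = starRingEnd ℂ c • contract x m (cons y t)
    rw [contract_cons, contract_cons, inner_smul_left, mul_smul]
  rw [LinearMap.smul_apply, coe_smul_apply, coe_annihilate₁_apply, coe_annihilate₁_apply, h,
    completion_smul, smul_apply, smul_comm]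

/-- `dΓ(|x⟩⟨y|) = a⁺(x) a⁻(y)`. -/
theorem dGamma_rankOne [CompleteSpace G] (x y : G) :
    dGamma (InnerProductSpace.rankOne ℂ x y) = create₁ x * annihilate₁ y := by
  have key : ∀ D : Module.End ℂ (FockFin G), (∀ g, D g 0 = 0) →
      (∀ f, annihilate₁ f * D = D * annihilate₁ f + ⟪f, x⟫_ℂ • annihilate₁ y) →
      D = create₁ x * annihilate₁ y := by
    intro D hvac h
    refine sub_eq_zero.1 (eq_zero_of_commute_annihilate₁ (fun g => ?_) fun f => ?_)
    · rw [LinearMap.sub_apply, DirectSum.sub_apply, hvac, Module.End.mul_apply, create₁_apply_zero,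
        sub_zero]
    · rw [Commute, SemiconjBy, end_mul_sub, end_sub_mul, h, ← mul_assoc, annihilate₁_mul_create₁,
        end_sub_mul, mul_assoc (create₁ x), annihilate₁_mul_annihilate₁ f y, smul_mul_assoc, one_mul,
        end_mul_neg, mul_assoc]
      abel
  refine key _ (fun g => Subtype.ext ?_) fun f => ?_
  · rw [coe_dGamma_apply, preDGamma, completion_zero, zero_apply, Submodule.coe_zero]
  · rw [annihilate₁_mul_dGamma, InnerProductSpace.adjoint_rankOne, InnerProductSpace.rankOne_apply,
      annihilate₁_smul, inner_conj_symm]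

end CAR

section Quadratic

variable {G : Type u} [NormedAddCommGroup G] [InnerProductSpace ℂ G]

/-! ### Two-particle operators of elementary tensors -/

theorem tensorLeft_coe_tmul (x y : G) {n : ℕ} (t : HTensor G n) :
    tensorLeft G n ((x ⊗ₜ[ℂ] y : G ⊗[ℂ] G) : Completion (G ⊗[ℂ] G)) t =
      (consL x (n + 1)).completion ((consL y n).completion t) := by
  have h1 : tensorLeft G n ((x ⊗ₜ[ℂ] y : G ⊗[ℂ] G) : Completion (G ⊗[ℂ] G)) =
      (preTensorLeft n (x ⊗ₜ[ℂ] y)).completion :=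
    ContinuousLinearMap.fromCompletion_apply_coe _ _
  have h2 : preTensorLeft n (x ⊗ₜ[ℂ] y) = consL x (n + 1) ∘L consL y n :=
    ContinuousLinearMap.ext fun s => rfl
  rw [h1, h2, completion_comp, ContinuousLinearMap.comp_apply]

theorem antisymmetrizer_consL_antisymmetrizer (f : G) {n : ℕ} (w : HTensor G n) :
    antisymmetrizer G (n + 1) ((consL f n).completion (antisymmetrizer G n w)) =
      antisymmetrizer G (n + 1) ((consL f n).completion w) := by
  refine ext_inner_left ℂ fun s => ?_
  rw [inner_antisymmetrizer, inner_antisymmetrizer, ← inner_completion_eq (inner_contract f),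
    ← inner_completion_eq (inner_contract f)]
  exact inner_antisymmetrizer ⟨_, contract_mem f s⟩ w

theorem create₂_tmul (x y : G) :
    create₂ ((x ⊗ₜ[ℂ] y : G ⊗[ℂ] G) : Completion (G ⊗[ℂ] G)) = create₁ x * create₁ y := by
  refine LinearMap.ext fun v => DFinsupp.ext fun m => ?_
  rw [Module.End.mul_apply]
  match m with
  | 0 => rw [create₂_apply_of_lt _ _ (by omega), create₁_apply_zero]
  | 1 =>
    rw [create₂_apply_of_lt _ _ (by omega), create₁_apply_succ, create₁_apply_zero,
      Submodule.coe_zero, map_zero, map_zero]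
  | m + 2 =>
    rw [create₂_apply_add_two, create₁_apply_succ, create₁_apply_succ,
      antisymmetrizer_consL_antisymmetrizer, ← tensorLeft_coe_tmul]
    rfl

theorem inner_create₂Aux (φ : Completion (G ⊗[ℂ] G)) {n : ℕ} (u : antisymm G n)
    (s : antisymm G (n + 2)) :
    ⟪create₂Aux φ n u, s⟫_ℂ = ⟪tensorLeft G n φ u, (s : HTensor G (n + 2))⟫_ℂ :=
  (antisymm G (n + 2)).inner_orthogonalProjectionOnto_eq_of_mem_right s (tensorLeft G n φ u)

theorem annihilate₂_tmul (x y : G) :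
    annihilate₂ ((x ⊗ₜ[ℂ] y : G ⊗[ℂ] G) : Completion (G ⊗[ℂ] G)) =
      annihilate₁ y * annihilate₁ x := by
  refine end_ext fun v m => ?_
  have hadj : ∀ s : antisymm G (m + 2), (ContinuousLinearMap.adjoint
      (create₂Aux ((x ⊗ₜ[ℂ] y : G ⊗[ℂ] G) : Completion (G ⊗[ℂ] G)) m) s : HTensor G m) =
      (contract y m).completion ((contract x (m + 1)).completion s) := by
    intro s
    have h : ContinuousLinearMap.adjoint
        (create₂Aux ((x ⊗ₜ[ℂ] y : G ⊗[ℂ] G) : Completion (G ⊗[ℂ] G)) m) s =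
        ⟨_, contract_mem y ⟨_, contract_mem x s⟩⟩ := by
      refine ext_inner_right ℂ fun u => ?_
      rw [ContinuousLinearMap.adjoint_inner_left, ← inner_conj_symm, inner_create₂Aux,
        tensorLeft_coe_tmul, inner_conj_symm, ← inner_completion_eq (inner_contract x),
        ← inner_completion_eq (inner_contract y)]
      rfl
    exact congrArg Subtype.val h
  rw [annihilate₂_apply, Module.End.mul_apply, coe_annihilate₁_apply, coe_annihilate₁_apply,
    map_smul, ← hadj, smul_smul]
  have h : (((m : ℂ) + 1) * (((m + 1 : ℕ) : ℂ) + 1)) = ((m : ℂ) + 2) * ((m : ℂ) + 1) := by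
    push_cast
    ring
  rw [h]
  rfl

/-! ### Linearity and continuity -/

theorem create₂Aux_add (φ ψ : Completion (G ⊗[ℂ] G)) (n : ℕ) :
    create₂Aux (φ + ψ) n = create₂Aux φ n + create₂Aux ψ n := by
  refine ContinuousLinearMap.ext fun t => ?_
  change antisymmetrizer G (n + 2) (tensorLeft G n (φ + ψ) t) =
    antisymmetrizer G (n + 2) (tensorLeft G n φ t) + antisymmetrizer G (n + 2) (tensorLeft G n ψ t)
  rw [map_add, add_apply, map_add]

theorem create₂_add (φ ψ : Completion (G ⊗[ℂ] G)) :
    create₂ (φ + ψ) = create₂ φ + create₂ ψ := by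
  refine LinearMap.ext fun v => DFinsupp.ext fun m => ?_
  rw [LinearMap.add_apply, DirectSum.add_apply]
  match m with
  | 0 => simp only [create₂_apply_of_lt _ _ (show 0 < 2 by omega), add_zero]
  | 1 => simp only [create₂_apply_of_lt _ _ (show 1 < 2 by omega), add_zero]
  | m + 2 => 
    rw [create₂_apply_add_two, create₂_apply_add_two, create₂_apply_add_two, create₂Aux_add]
    rfl

theorem annihilate₂_add (φ ψ : Completion (G ⊗[ℂ] G)) :
    annihilate₂ (φ + ψ) = annihilate₂ φ + annihilate₂ ψ := by
  refine LinearMap.ext fun v => DFinsupp.ext fun m => ?_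
  have h : annihilate₂Component (φ + ψ) m =
      annihilate₂Component φ m + annihilate₂Component ψ m := by
    refine LinearMap.ext fun t => ?_
    rw [annihilate₂Component, create₂Aux_add, map_add, smul_add]
    rfl
  rw [LinearMap.add_apply, DirectSum.add_apply, annihilate₂_apply, annihilate₂_apply,
    annihilate₂_apply, h]
  rfl

theorem end_eq_zero_of_eq_add_self {F : Module.End ℂ (FockFin G)} (h : F = F + F) : F = 0 :=
  LinearMap.ext fun g => DFinsupp.ext fun m => left_eq_add.1 (congrArg (fun F => F g m) h)

theorem create₂_zero : create₂ (0 : Completion (G ⊗[ℂ] G)) = 0 :=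
  end_eq_zero_of_eq_add_self (by rw [← create₂_add, add_zero])

theorem annihilate₂_zero : annihilate₂ (0 : Completion (G ⊗[ℂ] G)) = 0 :=
  end_eq_zero_of_eq_add_self (by rw [← annihilate₂_add, add_zero])

theorem preDGamma_add (B D : G →L[ℂ] G) (n : ℕ) :
    preDGamma (B + D) n = preDGamma B n + preDGamma D n := by
  induction n with
  | zero => rw [preDGamma, preDGamma, preDGamma, add_zero]
  | succ n ih =>
    refine ext_cons fun x t => ?_
    change preDGamma (B + D) (n + 1) (cons x t) =
      preDGamma B (n + 1) (cons x t) + preDGamma D (n + 1) (cons x t)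
    rw [preDGamma_cons, ih, preDGamma_cons, preDGamma_cons, add_apply, add_apply, cons_add_left,
      cons_add]
    abel

theorem dGamma_add (B D : G →L[ℂ] G) : dGamma (B + D) = dGamma B + dGamma D := by
  refine end_ext fun v m => ?_
  rw [LinearMap.add_apply, coe_add_apply, coe_dGamma_apply, coe_dGamma_apply, coe_dGamma_apply,
    preDGamma_add, completion_add, add_apply]

theorem preDGamma_smul (c : ℂ)
    (B : G →L[ℂ] G) (n : ℕ) : preDGamma (c • B) n = c • preDGamma B n := by
  induction n with
  | zero => rw [preDGamma, preDGamma, smul_zero]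
  | succ n ih =>
    refine ext_cons fun x t => ?_
    change preDGamma (c • B) (n + 1) (cons x t) = c • preDGamma B (n + 1) (cons x t)
    rw [preDGamma_cons, ih, preDGamma_cons, smul_apply, smul_apply, cons_smul_left, cons_smul,
      smul_add]

theorem dGamma_smul (c : ℂ)
    (B : G →L[ℂ] G) : dGamma (c • B) = c • dGamma B := by
  refine end_ext fun v m => ?_
  rw [LinearMap.smul_apply, coe_smul_apply, coe_dGamma_apply, coe_dGamma_apply, preDGamma_smul,
    completion_smul, smul_apply]

theorem continuous_preDGamma (n : ℕ) : Continuous fun B : G →L[ℂ] G => preDGamma B n := by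
  induction n with
  | zero => exact continuous_const
  | succ n ih =>
    have hr : LipschitzWith 1 fun B : G →L[ℂ] G => B.rTensor (PreTensor G n) :=
      LipschitzWith.of_dist_le_mul fun S T => by
        rw [dist_eq_norm, dist_eq_norm, ← ContinuousLinearMap.rTensor_sub, NNReal.coe_one, one_mul]
        exact ContinuousLinearMap.norm_rTensor_le _ (S - T)
    have hl : LipschitzWith 1 fun S : PreTensor G n →L[ℂ] PreTensor G n => S.lTensor G :=
      LipschitzWith.of_dist_le_mul fun S T => by
        rw [dist_eq_norm, dist_eq_norm, ← ContinuousLinearMap.lTensor_sub, NNReal.coe_one, one_mul]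
        exact ContinuousLinearMap.norm_lTensor_le _ (S - T)
    exact (continuous_const.clm_comp (hr.continuous.clm_comp continuous_const)).add
      (continuous_const.clm_comp ((hl.continuous.comp ih).clm_comp continuous_const))

/-- The topology of componentwise convergence on finite sequences. -/
instance fockTopology : TopologicalSpace (FockFin G) :=
  TopologicalSpace.induced (fun g n => g n) Pi.topologicalSpace

theorem continuous_fock_iff {Y : Type*} [TopologicalSpace Y] {F : Y → FockFin G} :
    Continuous F ↔ ∀ m, Continuous fun y => F y m :=
  continuous_induced_rng.trans continuous_pi_iff

theorem continuous_component (m : ℕ) : Continuous fun g : FockFin G => g m :=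
  continuous_fock_iff.1 continuous_id m

instance t2Space_fockFin : T2Space (FockFin G) :=
  T2Space.of_injective_continuous (f := fun (g : FockFin G) n => g n) DFunLike.coe_injective
    continuous_induced_dom

theorem continuous_fock_add {Y : Type*} [TopologicalSpace Y] {F F' : Y → FockFin G}
    (h : Continuous F) (h' : Continuous F') : Continuous fun y => F y + F' y :=
  continuous_fock_iff.2 fun m => (continuous_fock_iff.1 h m).add (continuous_fock_iff.1 h' m)

theorem continuous_fock_smul {Y : Type*} [TopologicalSpace Y] {c : Y → ℂ}
    (h : Continuous c) (g : FockFin G) : Continuous fun y => c y • g :=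
  continuous_fock_iff.2 fun m => h.smul (continuous_const (y := g m))

theorem continuous_create₂ (φ : Completion (G ⊗[ℂ] G)) : Continuous (create₂ φ) := by
  refine continuous_fock_iff.2 fun m => ?_
  match m with
  | 0 => simpa only [create₂_apply_of_lt _ _ (show 0 < 2 by omega)] using continuous_const
  | 1 => simpa only [create₂_apply_of_lt _ _ (show 1 < 2 by omega)] using continuous_const
  | m + 2 =>
    exact ((create₂Aux φ m).continuous.comp (continuous_component m)).congr fun g =>
      (create₂_apply_add_two φ g m).symm

theorem continuous_annihilate₂ (φ : Completion (G ⊗[ℂ] G)) : Continuous (annihilate₂ φ) := by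
  refine continuous_fock_iff.2 fun m => ?_
  exact (((((m : ℂ) + 2) * ((m : ℂ) + 1)) •
    (ContinuousLinearMap.adjoint (create₂Aux φ m))).continuous.comp
      (continuous_component (m + 2))).congr fun g => (annihilate₂_apply φ g m).symm

theorem continuous_dGamma (B : G →L[ℂ] G) : Continuous (dGamma B) := by
  refine continuous_fock_iff.2 fun m => ?_
  refine continuous_induced_rng.2 ?_
  have h : (Subtype.val ∘ fun g => dGamma B g m) =
      fun g : FockFin G => (preDGamma B m).completion (g m) := funext fun g => coe_dGamma_apply B g m
  rw [h]
  exact (preDGamma B m).completion.continuous.comp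
    (continuous_subtype_val.comp (continuous_component m))

theorem continuous_create₂Aux (n : ℕ) :
    Continuous fun φ : Completion (G ⊗[ℂ] G) => create₂Aux φ n :=
  continuous_const.clm_comp (((tensorLeft G n).continuous).clm_comp continuous_const)

theorem continuous_create₂_left (g : FockFin G) :
    Continuous fun φ : Completion (G ⊗[ℂ] G) => create₂ φ g := by
  refine continuous_fock_iff.2 fun m => ?_
  match m with
  | 0 => simpa only [create₂_apply_of_lt _ _ (show 0 < 2 by omega)] using continuous_const
  | 1 => simpa only [create₂_apply_of_lt _ _ (show 1 < 2 by omega)] using continuous_const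
  | m + 2 =>
    exact ((continuous_create₂Aux m).clm_apply continuous_const).congr fun φ =>
      (create₂_apply_add_two φ g m).symm

theorem continuous_annihilate₂_left (g : FockFin G) :
    Continuous fun φ : Completion (G ⊗[ℂ] G) => annihilate₂ φ g := by
  refine continuous_fock_iff.2 fun m => ?_
  have h : Continuous fun φ : Completion (G ⊗[ℂ] G) =>
      ContinuousLinearMap.adjoint (create₂Aux φ m) :=
    (ContinuousLinearMap.adjoint (𝕜 := ℂ) (E := antisymm G m)
      (F := antisymm G (m + 2))).continuous.comp (continuous_create₂Aux m)
  exact ((h.clm_apply continuous_const).const_smul (((m : ℂ) + 2) * ((m : ℂ) + 1))).congr fun φ =>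
    (annihilate₂_apply φ g m).symm

theorem continuous_dGamma_left (g : FockFin G) :
    Continuous fun B : G →L[ℂ] G => dGamma B g := by
  refine continuous_fock_iff.2 fun m => continuous_induced_rng.2 ?_
  have h : (Subtype.val ∘ fun B : G →L[ℂ] G => dGamma B g m) =
      fun B : G →L[ℂ] G => (preDGamma B m).completion (g m) :=
    funext fun B => coe_dGamma_apply B g m
  rw [h]
  exact (continuous_completion.comp (continuous_preDGamma m)).clm_apply continuous_const

/-- A closed additive property of elements of a completed tensor product holds everywhere as soon as
it holds for elementary tensors. -/
theorem completion_tensor_induction {E F : Type*} [NormedAddCommGroup E] [InnerProductSpace ℂ E]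
    [NormedAddCommGroup F] [InnerProductSpace ℂ F] {p : Completion (E ⊗[ℂ] F) → Prop}
    (κ : Completion (E ⊗[ℂ] F)) (closed : IsClosed {κ | p κ}) (zero : p 0)
    (add : ∀ a b, p a → p b → p (a + b))
    (tmul : ∀ x y, p ((x ⊗ₜ[ℂ] y : E ⊗[ℂ] F) : Completion (E ⊗[ℂ] F))) : p κ := by
  induction κ using Completion.induction_on with
  | hp => exact closed
  | ih κ =>
    induction κ with
    | zero => exact zero
    | tmul x y => exact tmul x y
    | add a b ha hb => rw [Completion.coe_add]; exact add _ _ ha hb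

/-! ### Commutation relations of the two-particle operators -/

/-- Products of two pairwise anticommuting elements commute. -/
theorem mul_mul_comm_of_anticommute {R : Type*} [Ring R] {a b c d : R} (hac : a * c = -(c * a))
    (had : a * d = -(d * a)) (hbc : b * c = -(c * b)) (hbd : b * d = -(d * b)) :
    (a * b) * (c * d) = (c * d) * (a * b) := by
  calc (a * b) * (c * d) = a * (b * c) * d := by noncomm_ring
    _ = -((a * c) * (b * d)) := by rw [hbc]; noncomm_ring
    _ = -(c * (a * d) * b) := by rw [hac, hbd]; noncomm_ring
    _ = (c * d) * (a * b) := by rw [had]; noncomm_ring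

theorem commute_create₂ (φ ψ : Completion (G ⊗[ℂ] G)) :
    (create₂ φ : Module.End ℂ (FockFin G)) * create₂ ψ = create₂ ψ * create₂ φ := by
  refine LinearMap.ext fun g => ?_
  change create₂ φ (create₂ ψ g) = create₂ ψ (create₂ φ g)
  induction φ using completion_tensor_induction with
  | closed =>
    exact isClosed_eq (continuous_create₂_left _)
      ((continuous_create₂ ψ).comp (continuous_create₂_left g))
  | zero => simp only [create₂_zero, LinearMap.zero_apply, map_zero]
  | add a b ha hb => simp only [create₂_add, LinearMap.add_apply, map_add, ha, hb]
  | tmul x y =>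
    induction ψ using completion_tensor_induction with
    | closed =>
      exact isClosed_eq ((continuous_create₂ _).comp (continuous_create₂_left g))
        (continuous_create₂_left _)
    | zero => simp only [create₂_zero, LinearMap.zero_apply, map_zero]
    | add a b ha hb => simp only [create₂_add, LinearMap.add_apply, map_add, ha, hb]
    | tmul z w =>
      rw [create₂_tmul, create₂_tmul]
      exact DFunLike.congr_fun (mul_mul_comm_of_anticommute (R := Module.End ℂ (FockFin G))
        (create₁_mul_create₁ x z)
        (create₁_mul_create₁ x w) (create₁_mul_create₁ y z) (create₁_mul_create₁ y w)) g

theorem commute_annihilate₂ (φ ψ : Completion (G ⊗[ℂ] G)) :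
    (annihilate₂ φ : Module.End ℂ (FockFin G)) * annihilate₂ ψ =
      annihilate₂ ψ * annihilate₂ φ := by
  refine LinearMap.ext fun g => ?_
  change annihilate₂ φ (annihilate₂ ψ g) = annihilate₂ ψ (annihilate₂ φ g)
  induction φ using completion_tensor_induction with
  | closed =>
    exact isClosed_eq (continuous_annihilate₂_left _)
      ((continuous_annihilate₂ ψ).comp (continuous_annihilate₂_left g))
  | zero => simp only [annihilate₂_zero, LinearMap.zero_apply, map_zero]
  | add a b ha hb => simp only [annihilate₂_add, LinearMap.add_apply, map_add, ha, hb]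
  | tmul x y =>
    induction ψ using completion_tensor_induction with
    | closed =>
      exact isClosed_eq ((continuous_annihilate₂ _).comp (continuous_annihilate₂_left g))
        (continuous_annihilate₂_left _)
    | zero => simp only [annihilate₂_zero, LinearMap.zero_apply, map_zero]
    | add a b ha hb => simp only [annihilate₂_add, LinearMap.add_apply, map_add, ha, hb]
    | tmul z w =>
      rw [annihilate₂_tmul, annihilate₂_tmul]
      exact DFunLike.congr_fun (mul_mul_comm_of_anticommute (R := Module.End ℂ (FockFin G))
        (annihilate₁_mul_annihilate₁ y w)
        (annihilate₁_mul_annihilate₁ y z) (annihilate₁_mul_annihilate₁ x w)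
        (annihilate₁_mul_annihilate₁ x z)) g

/-- The operator `B ⊗ 𝟏 + 𝟏 ⊗ B` in `G^{⊗2}`. -/
def legSum (B : G →L[ℂ] G) : Completion (G ⊗[ℂ] G) →L[ℂ] Completion (G ⊗[ℂ] G) :=
  (B.rTensor G + B.lTensor G).completion

theorem legSum_tmul (B : G →L[ℂ] G) (x y : G) :
    legSum B ((x ⊗ₜ[ℂ] y : G ⊗[ℂ] G) : Completion (G ⊗[ℂ] G)) =
      ((B x ⊗ₜ[ℂ] y : G ⊗[ℂ] G) : Completion (G ⊗[ℂ] G)) + ((x ⊗ₜ[ℂ] B y : G ⊗[ℂ] G)) := by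
  rw [legSum, ContinuousLinearMap.completion_apply_coe, add_apply, Completion.coe_add]
  rfl

/-- Moving a derivation past a product of two elements. -/
theorem derivation_mul_mul {R : Type*} [Ring R] {D a b a' b' : R} (ha : D * a = a * D + a')
    (hb : D * b = b * D + b') : D * (a * b) = a * b * D + (a' * b + a * b') := by
  rw [← mul_assoc, ha, add_mul, mul_assoc, hb]
  noncomm_ring

theorem dGamma_mul_create₂ (B : G →L[ℂ] G) (φ : Completion (G ⊗[ℂ] G)) :
    (dGamma B : Module.End ℂ (FockFin G)) * create₂ φ =
      create₂ φ * dGamma B + create₂ (legSum B φ) := by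
  refine LinearMap.ext fun g => ?_
  change dGamma B (create₂ φ g) = create₂ φ (dGamma B g) + create₂ (legSum B φ) g
  induction φ using completion_tensor_induction with
  | closed =>
    exact isClosed_eq ((continuous_dGamma B).comp (continuous_create₂_left g))
      (continuous_fock_add (continuous_create₂_left _)
        ((continuous_create₂_left g).comp (legSum B).continuous))
  | zero => simp only [create₂_zero, LinearMap.zero_apply, map_zero, add_zero]
  | add a b ha hb =>
    simp only [create₂_add, LinearMap.add_apply, map_add, ha, hb]
    abel
  | tmul x y =>
    rw [legSum_tmul, create₂_add, create₂_tmul, create₂_tmul, create₂_tmul]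
    exact DFunLike.congr_fun (derivation_mul_mul (R := Module.End ℂ (FockFin G))
        (dGamma_mul_create₁ B x)
      (dGamma_mul_create₁ B y)) g

/-- Moving a product of two elements past a derivation. -/
theorem mul_mul_derivation {R : Type*} [Ring R] {D a b a' b' : R} (ha : a * D = D * a + a')
    (hb : b * D = D * b + b') : a * b * D = D * (a * b) + (a * b' + a' * b) := by
  rw [mul_assoc, hb, mul_add, ← mul_assoc, ha]
  noncomm_ring

theorem annihilate₂_mul_dGamma [CompleteSpace G] (B : G →L[ℂ] G) (φ : Completion (G ⊗[ℂ] G)) :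
    (annihilate₂ φ : Module.End ℂ (FockFin G)) * dGamma B =
      dGamma B * annihilate₂ φ + annihilate₂ (legSum (ContinuousLinearMap.adjoint B) φ) := by
  refine LinearMap.ext fun g => ?_
  change annihilate₂ φ (dGamma B g) =
    dGamma B (annihilate₂ φ g) + annihilate₂ (legSum (ContinuousLinearMap.adjoint B) φ) g
  induction φ using completion_tensor_induction with
  | closed =>
    exact isClosed_eq (continuous_annihilate₂_left _)
      (continuous_fock_add ((continuous_dGamma B).comp (continuous_annihilate₂_left g))
        ((continuous_annihilate₂_left g).comp (legSum _).continuous))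
  | zero => simp only [annihilate₂_zero, LinearMap.zero_apply, map_zero, add_zero]
  | add a b ha hb =>
    simp only [annihilate₂_add, LinearMap.add_apply, map_add, ha, hb]
    abel
  | tmul x y =>
    rw [legSum_tmul, annihilate₂_add, annihilate₂_tmul, annihilate₂_tmul, annihilate₂_tmul]
    exact DFunLike.congr_fun (mul_mul_derivation (R := Module.End ℂ (FockFin G))
        (annihilate₁_mul_dGamma B y)
      (annihilate₁_mul_dGamma B x)) g

end Quadratic

section Kernels

variable {X : Type u} [MeasurableSpace X] {σ : Measure X}

/-! ### Integral kernels of Hilbert–Schmidt operators -/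

theorem inner_conjL2_left (f g : L2 σ) : ⟪conjL2 σ f, g⟫_ℂ = ⟪conjL2 σ g, f⟫_ℂ := by
  rw [← inner_conjL2, conjL2_conjL2]

theorem conjOp_apply (B : L2 σ →L[ℂ] L2 σ) (f : L2 σ) :
    conjOp B f = conjL2 σ (B (conjL2 σ f)) := rfl

theorem inner_conjOp_star_left (B : L2 σ →L[ℂ] L2 σ) (f g : L2 σ) :
    ⟪conjOp (star B) f, g⟫_ℂ = ⟪f, conjOp B g⟫_ℂ := by
  rw [conjOp_apply, conjOp_apply, inner_conjL2_left, ContinuousLinearMap.star_eq_adjoint,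
    ContinuousLinearMap.adjoint_inner_right, ← inner_conjL2, conjL2_conjL2]

theorem star_conjOp (B : L2 σ →L[ℂ] L2 σ) : star (conjOp B) = conjOp (star B) := by
  rw [ContinuousLinearMap.star_eq_adjoint]
  exact ((ContinuousLinearMap.eq_adjoint_iff _ _).2 (inner_conjOp_star_left B)).symm

theorem conjOp_mul (B D : L2 σ →L[ℂ] L2 σ) : conjOp (B * D) = conjOp B * conjOp D := by
  refine ContinuousLinearMap.ext fun f => ?_
  rw [mul_apply_eq_comp, conjOp_apply, conjOp_apply, conjOp_apply, conjL2_conjL2]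
  rfl

theorem conjOp_add (B D : L2 σ →L[ℂ] L2 σ) : conjOp (B + D) = conjOp B + conjOp D :=
  ContinuousLinearMap.ext fun f => map_add (conjL2 σ) (B (conjL2 σ f)) (D (conjL2 σ f))

theorem conjOp_sub (B D : L2 σ →L[ℂ] L2 σ) : conjOp (B - D) = conjOp B - conjOp D :=
  ContinuousLinearMap.ext fun f => map_sub (conjL2 σ) (B (conjL2 σ f)) (D (conjL2 σ f))

theorem continuous_conjOp : Continuous (conjOp : (L2 σ →L[ℂ] L2 σ) → L2 σ →L[ℂ] L2 σ) := by
  have h : LipschitzWith 1 (conjOp : (L2 σ →L[ℂ] L2 σ) → L2 σ →L[ℂ] L2 σ) :=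
    LipschitzWith.of_dist_le_mul fun B D => by
      rw [dist_eq_norm, dist_eq_norm, ← conjOp_sub, NNReal.coe_one, one_mul]
      refine ContinuousLinearMap.opNorm_le_bound _ (norm_nonneg _) fun f => ?_
      have h1 : ‖conjOp (B - D) f‖ = ‖(B - D) (conjL2 σ f)‖ := norm_conj_eq _
      have h2 : ‖conjL2 σ f‖ = ‖f‖ := norm_conj_eq f
      rw [h1, ← h2]
      exact (B - D).le_opNorm _
  exact h.continuous

theorem IsKernelTensor.add {T S : L2 σ →L[ℂ] L2 σ} {k l : Completion (L2 σ ⊗[ℂ] L2 σ)}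
    (hk : IsKernelTensor T k) (hl : IsKernelTensor S l) : IsKernelTensor (T + S) (k + l) :=
  fun φ ψ => by rw [inner_add_right, hk, hl, add_apply, inner_add_right]

theorem IsKernelTensor.sub {T S : L2 σ →L[ℂ] L2 σ} {k l : Completion (L2 σ ⊗[ℂ] L2 σ)}
    (hk : IsKernelTensor T k) (hl : IsKernelTensor S l) : IsKernelTensor (T - S) (k - l) :=
  fun φ ψ => by rw [inner_sub_right, hk, hl, sub_apply, inner_sub_right]

theorem inner_rTensor_star (B : L2 σ →L[ℂ] L2 σ) (x y : L2 σ ⊗[ℂ] L2 σ) :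
    ⟪(star B).rTensor (L2 σ) x, y⟫_ℂ = ⟪x, B.rTensor (L2 σ) y⟫_ℂ := by
  induction x with
  | zero => simp
  | add a b ha hb => rw [map_add, inner_add_left, inner_add_left, ha, hb]
  | tmul p q =>
    induction y with
    | zero => simp
    | add a b ha hb => rw [map_add, inner_add_right, inner_add_right, ha, hb]
    | tmul r s =>
      rw [ContinuousLinearMap.rTensor_tmul, ContinuousLinearMap.rTensor_tmul,
        TensorProduct.inner_tmul, TensorProduct.inner_tmul, ContinuousLinearMap.star_eq_adjoint,
        ContinuousLinearMap.adjoint_inner_left]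

theorem inner_lTensor_star (B : L2 σ →L[ℂ] L2 σ) (x y : L2 σ ⊗[ℂ] L2 σ) :
    ⟪(star B).lTensor (L2 σ) x, y⟫_ℂ = ⟪x, B.lTensor (L2 σ) y⟫_ℂ := by
  induction x with
  | zero => simp
  | add a b ha hb => rw [map_add, inner_add_left, inner_add_left, ha, hb]
  | tmul p q =>
    induction y with
    | zero => simp
    | add a b ha hb => rw [map_add, inner_add_right, inner_add_right, ha, hb]
    | tmul r s =>
      rw [ContinuousLinearMap.lTensor_tmul, ContinuousLinearMap.lTensor_tmul,
        TensorProduct.inner_tmul, TensorProduct.inner_tmul, ContinuousLinearMap.star_eq_adjoint,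
        ContinuousLinearMap.adjoint_inner_left]

/-- The kernel of `B T` is `(B ⊗ 𝟏) k`. -/
theorem IsKernelTensor.mul_left {T : L2 σ →L[ℂ] L2 σ} {k : Completion (L2 σ ⊗[ℂ] L2 σ)}
    (hk : IsKernelTensor T k) (B : L2 σ →L[ℂ] L2 σ) :
    IsKernelTensor (B * T) ((B.rTensor (L2 σ)).completion k) := fun φ ψ => by
  rw [← inner_completion_eq (inner_rTensor_star B), ContinuousLinearMap.completion_apply_coe,
    ContinuousLinearMap.rTensor_tmul, hk, ContinuousLinearMap.star_eq_adjoint,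
    ContinuousLinearMap.adjoint_inner_left]
  rfl

/-- The kernel of `T C` is `(𝟏 ⊗ Cᵀ) k`, where the transpose `Cᵀ` is the conjugate of `C*`. -/
theorem IsKernelTensor.mul_right {T : L2 σ →L[ℂ] L2 σ} {k : Completion (L2 σ ⊗[ℂ] L2 σ)}
    (hk : IsKernelTensor T k) (C : L2 σ →L[ℂ] L2 σ) :
    IsKernelTensor (T * C) (((conjOp (star C)).lTensor (L2 σ)).completion k) := fun φ ψ => by
  rw [← inner_completion_eq (inner_lTensor_star _), ContinuousLinearMap.completion_apply_coe,
    ContinuousLinearMap.lTensor_tmul, hk, star_conjOp, star_star, conjOp_apply, conjL2_conjL2]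
  rfl

/-- The antilinear map `φ ⊗ ψ ↦ conj ψ ⊗ conj φ`. -/
def preKernelFlip : L2 σ ⊗[ℂ] L2 σ →ₗ⋆[ℂ] L2 σ ⊗[ℂ] L2 σ :=
  (TensorProduct.comm ℂ (L2 σ) (L2 σ)).toLinearMap.comp
    (TensorProduct.map (conjL2 σ).toLinearMap (conjL2 σ).toLinearMap)

theorem preKernelFlip_tmul (p q : L2 σ) : preKernelFlip (p ⊗ₜ[ℂ] q) = conjL2 σ q ⊗ₜ[ℂ] conjL2 σ p := rfl

theorem inner_preKernelFlip (x y : L2 σ ⊗[ℂ] L2 σ) : ⟪preKernelFlip x, preKernelFlip y⟫_ℂ = ⟪y, x⟫_ℂ := by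
  induction x with
  | zero => simp
  | add a b ha hb => rw [map_add, inner_add_left, inner_add_right, ha, hb]
  | tmul p q =>
    induction y with
    | zero => simp
    | add a b ha hb => rw [map_add, inner_add_right, inner_add_left, ha, hb]
    | tmul r s =>
      rw [preKernelFlip_tmul, preKernelFlip_tmul, TensorProduct.inner_tmul, TensorProduct.inner_tmul,
        inner_conjL2, inner_conjL2, mul_comm]

/-- The antiunitary map `k(x, y) ↦ conj k(y, x)` on integral kernels. -/
def kernelFlip : Completion (L2 σ ⊗[ℂ] L2 σ) →L⋆[ℂ] Completion (L2 σ ⊗[ℂ] L2 σ) :=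
  (LinearMap.mkContinuous preKernelFlip 1 fun x => by
    rw [one_mul, norm_eq_sqrt_re_inner (𝕜 := ℂ), norm_eq_sqrt_re_inner (𝕜 := ℂ) x,
      inner_preKernelFlip]).completion

theorem kernelFlip_coe (x : L2 σ ⊗[ℂ] L2 σ) :
    kernelFlip (x : Completion (L2 σ ⊗[ℂ] L2 σ)) = (preKernelFlip x : L2 σ ⊗[ℂ] L2 σ) :=
  ContinuousLinearMap.completion_apply_coe _ x

theorem inner_kernelFlip (x y : Completion (L2 σ ⊗[ℂ] L2 σ)) : ⟪kernelFlip x, kernelFlip y⟫_ℂ = ⟪y, x⟫_ℂ := by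
  induction x, y using Completion.induction_on₂ with
  | hp => exact isClosed_eq (by fun_prop) (by fun_prop)
  | ih x y => rw [kernelFlip_coe, kernelFlip_coe, Completion.inner_coe, Completion.inner_coe, inner_preKernelFlip]

/-- The kernel of `T*` is `conj k(y, x)`. -/
theorem IsKernelTensor.star {T : L2 σ →L[ℂ] L2 σ} {k : Completion (L2 σ ⊗[ℂ] L2 σ)}
    (hk : IsKernelTensor T k) : IsKernelTensor (star T) (kernelFlip k) := fun φ ψ => by
  have h : ((φ ⊗ₜ[ℂ] ψ : L2 σ ⊗[ℂ] L2 σ) : Completion (L2 σ ⊗[ℂ] L2 σ)) =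
      kernelFlip ((conjL2 σ ψ ⊗ₜ[ℂ] conjL2 σ φ : L2 σ ⊗[ℂ] L2 σ) : Completion (L2 σ ⊗[ℂ] L2 σ)) := by
    rw [kernelFlip_coe, preKernelFlip_tmul, conjL2_conjL2, conjL2_conjL2]
  rw [h, inner_kernelFlip, ← inner_conj_symm, hk, conjL2_conjL2, inner_conj_symm,
    ContinuousLinearMap.star_eq_adjoint, ContinuousLinearMap.adjoint_inner_right]

/-- The operator with a given integral kernel, for a kernel in the algebraic tensor product. -/
def preKernelOp : L2 σ ⊗[ℂ] L2 σ →ₗ[ℂ] L2 σ →L[ℂ] L2 σ :=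
  TensorProduct.lift (LinearMap.mk₂ ℂ
    (fun p q => InnerProductSpace.rankOne ℂ p (conjL2 σ q))
    (fun p p' q => by rw [map_add, add_apply])
    (fun c p q => by rw [map_smul, smul_apply])
    (fun p q q' => by rw [map_add, map_add])
    (fun c p q => by
      rw [ContinuousLinearMap.map_smulₛₗ, ContinuousLinearMap.map_smulₛₗ, Complex.conj_conj]))

theorem preKernelOp_tmul (p q : L2 σ) :
    preKernelOp (p ⊗ₜ[ℂ] q) = InnerProductSpace.rankOne ℂ p (conjL2 σ q) := rfl

theorem inner_preKernelOp (k : L2 σ ⊗[ℂ] L2 σ) (φ ψ : L2 σ) :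
    ⟪φ ⊗ₜ[ℂ] ψ, k⟫_ℂ = ⟪φ, preKernelOp k (conjL2 σ ψ)⟫_ℂ := by
  induction k with
  | zero => simp
  | add a b ha hb => rw [inner_add_right, map_add, add_apply, inner_add_right, ha, hb]
  | tmul p q =>
    rw [TensorProduct.inner_tmul, preKernelOp_tmul, InnerProductSpace.rankOne_apply,
      inner_smul_right, inner_conjL2, mul_comm]

theorem norm_preKernelOp_le (k : L2 σ ⊗[ℂ] L2 σ) : ‖preKernelOp k‖ ≤ ‖k‖ := by
  refine ContinuousLinearMap.opNorm_le_bound _ (norm_nonneg _) fun ψ => ?_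
  set x := preKernelOp k ψ with hx
  have h1 : ⟪x ⊗ₜ[ℂ] conjL2 σ ψ, k⟫_ℂ = ⟪x, x⟫_ℂ := by
    rw [inner_preKernelOp, conjL2_conjL2]
  have h2 : ‖x‖ * ‖x‖ ≤ ‖x‖ * (‖k‖ * ‖ψ‖) := by
    have h3 := norm_inner_le_norm (𝕜 := ℂ) (x ⊗ₜ[ℂ] conjL2 σ ψ) k
    have h4 : ‖conjL2 σ ψ‖ = ‖ψ‖ := norm_conj_eq ψ
    have h5 : ‖⟪x, x⟫_ℂ‖ = ‖x‖ * ‖x‖ := by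
      rw [inner_self_eq_norm_sq_to_K]
      simp [pow_two]
    rw [h1, h5, TensorProduct.norm_tmul, h4, mul_assoc, mul_comm ‖ψ‖] at h3
    exact h3
  rcases eq_or_lt_of_le (norm_nonneg x) with h | h
  · rw [← h]; positivity
  · exact le_of_mul_le_mul_left h2 h

/-- The operator with a given integral kernel. -/
def kernelOp : Completion (L2 σ ⊗[ℂ] L2 σ) →L[ℂ] L2 σ →L[ℂ] L2 σ :=
  (LinearMap.mkContinuous preKernelOp 1 fun k => by
    rw [one_mul]; exact norm_preKernelOp_le k).fromCompletion

theorem kernelOp_coe (k : L2 σ ⊗[ℂ] L2 σ) :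
    kernelOp (k : Completion (L2 σ ⊗[ℂ] L2 σ)) = preKernelOp k :=
  ContinuousLinearMap.fromCompletion_apply_coe _ k

theorem isKernelTensor_kernelOp (k : Completion (L2 σ ⊗[ℂ] L2 σ)) :
    IsKernelTensor (kernelOp k) k := fun φ ψ => by
  induction k using Completion.induction_on with
  | hp => exact isClosed_eq (by fun_prop) (by fun_prop)
  | ih k => rw [Completion.inner_coe, inner_preKernelOp, kernelOp_coe]

theorem IsKernelTensor.eq_kernelOp {T : L2 σ →L[ℂ] L2 σ} {k : Completion (L2 σ ⊗[ℂ] L2 σ)}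
    (hk : IsKernelTensor T k) : T = kernelOp k := by
  refine ContinuousLinearMap.ext fun ψ => ext_inner_left ℂ fun φ => ?_
  rw [← conjL2_conjL2 ψ, ← hk, isKernelTensor_kernelOp]

theorem IsKernelTensor.kernelTensor {T : L2 σ →L[ℂ] L2 σ} {k : Completion (L2 σ ⊗[ℂ] L2 σ)}
    (hk : IsKernelTensor T k) : IsKernelTensor T (kernelTensor T) := by
  have h : ∃ k, IsKernelTensor T k := ⟨k, hk⟩
  rw [ParticleDensity.kernelTensor, dif_pos h]
  exact h.choose_spec

theorem IsKernelTensor.kernelTensor_eq {T : L2 σ →L[ℂ] L2 σ} {k : Completion (L2 σ ⊗[ℂ] L2 σ)}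
    (hk : IsKernelTensor T k) : ParticleDensity.kernelTensor T = k :=
  hk.kernelTensor.unique hk

/-! ### The Hilbert–Schmidt inner product -/

/-- `T` is a Hilbert–Schmidt operator, expressed by the existence of a square-integrable kernel. -/
def IsHS (T : L2 σ →L[ℂ] L2 σ) : Prop := IsKernelTensor T (kernelTensor T)

/-- The Hilbert–Schmidt inner product `Tr(T* S)`. -/
def hsInner (T S : L2 σ →L[ℂ] L2 σ) : ℂ := ⟪kernelTensor T, kernelTensor S⟫_ℂ

theorem IsHS.sub {T S : L2 σ →L[ℂ] L2 σ} (hT : IsHS T) (hS : IsHS S) : IsHS (T - S) :=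
  (IsKernelTensor.sub hT hS).kernelTensor

theorem IsHS.mul_left {T : L2 σ →L[ℂ] L2 σ} (hT : IsHS T) (B : L2 σ →L[ℂ] L2 σ) : IsHS (B * T) :=
  (IsKernelTensor.mul_left hT B).kernelTensor

theorem IsHS.mul_right {T : L2 σ →L[ℂ] L2 σ} (hT : IsHS T) (B : L2 σ →L[ℂ] L2 σ) : IsHS (T * B) :=
  (IsKernelTensor.mul_right hT B).kernelTensor

theorem IsHS.star {T : L2 σ →L[ℂ] L2 σ} (hT : IsHS T) : IsHS (star T) :=
  (IsKernelTensor.star hT).kernelTensor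

theorem kernelTensor_sub {T S : L2 σ →L[ℂ] L2 σ} (hT : IsHS T) (hS : IsHS S) :
    kernelTensor (T - S) = kernelTensor T - kernelTensor S :=
  (IsKernelTensor.sub hT hS).kernelTensor_eq

theorem hsInner_conj_symm (T S : L2 σ →L[ℂ] L2 σ) :
    starRingEnd ℂ (hsInner T S) = hsInner S T := inner_conj_symm _ _

theorem hsInner_sub_left {T S : L2 σ →L[ℂ] L2 σ} (R : L2 σ →L[ℂ] L2 σ) (hT : IsHS T)
    (hS : IsHS S) : hsInner (T - S) R = hsInner T R - hsInner S R := by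
  rw [hsInner, kernelTensor_sub hT hS, inner_sub_left]
  rfl

theorem hsInner_sub_right {T S : L2 σ →L[ℂ] L2 σ} (R : L2 σ →L[ℂ] L2 σ) (hT : IsHS T)
    (hS : IsHS S) : hsInner R (T - S) = hsInner R T - hsInner R S := by
  rw [hsInner, kernelTensor_sub hT hS, inner_sub_right]
  rfl

theorem hsInner_mul_left {T S : L2 σ →L[ℂ] L2 σ} (B : L2 σ →L[ℂ] L2 σ) (hT : IsHS T)
    (hS : IsHS S) : hsInner (star B * T) S = hsInner T (B * S) := by
  rw [hsInner, hsInner, (IsKernelTensor.mul_left hT _).kernelTensor_eq,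
    (IsKernelTensor.mul_left hS _).kernelTensor_eq, inner_completion_eq (inner_rTensor_star B)]

theorem hsInner_mul_right {T S : L2 σ →L[ℂ] L2 σ} (C : L2 σ →L[ℂ] L2 σ) (hT : IsHS T)
    (hS : IsHS S) : hsInner (T * star C) S = hsInner T (S * C) := by
  rw [hsInner, hsInner, (IsKernelTensor.mul_right hT _).kernelTensor_eq,
    (IsKernelTensor.mul_right hS _).kernelTensor_eq, star_star, ← star_conjOp C,
    ← inner_completion_eq (inner_lTensor_star _), star_star]

theorem hsInner_star {T S : L2 σ →L[ℂ] L2 σ} (hT : IsHS T) (hS : IsHS S) :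
    hsInner (star T) (star S) = hsInner S T := by
  rw [hsInner, (IsKernelTensor.star hT).kernelTensor_eq, (IsKernelTensor.star hS).kernelTensor_eq,
    inner_kernelFlip]
  rfl

theorem abs_star_mul_self {H : Type u} [NormedAddCommGroup H] [InnerProductSpace ℂ H]
    [CompleteSpace H] (R : H →L[ℂ] H) : CFC.abs (star R * R) = star R * R :=
  CFC.abs_of_nonneg _ (star_mul_self_nonneg R)

/-- An operator `R` with `R* R` of trace class is Hilbert–Schmidt. -/
theorem isHS_of_isTraceClass {R : L2 σ →L[ℂ] L2 σ} (h : IsTraceClass (star R * R)) : IsHS R := by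
  obtain ⟨w, e, -⟩ := exists_hilbertBasis ℂ (L2 σ)
  have h1 := h w e
  rw [abs_star_mul_self] at h1
  refine exists_isKernelTensor e ?_
  have h2 : ∀ i, ⟪e i, (star R * R) (e i)⟫_ℂ = ((‖R (e i)‖ ^ 2 : ℝ) : ℂ) := fun i => by
    rw [mul_apply_eq_comp, ContinuousLinearMap.star_eq_adjoint,
      ContinuousLinearMap.adjoint_inner_right, inner_self_eq_norm_sq_to_K]
    push_cast
    rfl
  simp only [h2] at h1
  exact Complex.summable_ofReal.1 h1

end Kernels

section Projections

variable {X : Type u} [MeasurableSpace X] {σ : Measure X}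

/-! ### Projections onto the functions supported in a set -/

theorem proj_apply_ae {S : Set X} (hS : MeasurableSet S) (f : L2 σ) :
    proj σ S f =ᵐ[σ] S.indicator f := by
  have hmem : MemLp (S.indicator f) 2 σ := (Lp.memLp f).indicator hS
  have hg : hmem.toLp _ ∈ L2On σ S := by
    refine (ae_restrict_iff' hS.compl).2 ?_
    filter_upwards [hmem.coeFn_toLp] with x hx hxS
    rw [hx, Set.indicator_of_notMem hxS, Pi.zero_apply]
  have horth : ∀ w ∈ L2On σ S, ⟪f - hmem.toLp _, w⟫_ℂ = 0 := by
    intro w hw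
    rw [L2.inner_def]
    refine integral_eq_zero_of_ae ?_
    filter_upwards [Lp.coeFn_sub f (hmem.toLp _), hmem.coeFn_toLp,
      (ae_restrict_iff' hS.compl).1 hw] with x h1 h2 h3
    rw [h1, Pi.sub_apply, h2, Pi.zero_apply]
    by_cases hx : x ∈ S
    · rw [Set.indicator_of_mem hx, sub_self, inner_zero_left]
    · rw [h3 hx, Pi.zero_apply, inner_zero_right]
  rw [proj, Submodule.eq_starProjection_of_mem_of_inner_eq_zero hg horth]
  exact hmem.coeFn_toLp

theorem proj_mul_proj {S T : Set X} (hS : MeasurableSet S) (hT : MeasurableSet T) :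
    proj σ S * proj σ T = proj σ (S ∩ T) := by
  refine ContinuousLinearMap.ext fun f => Lp.ext ?_
  rw [mul_apply_eq_comp]
  filter_upwards [proj_apply_ae hS (proj σ T f), proj_apply_ae hT f,
    proj_apply_ae (hS.inter hT) f] with x h1 h2 h3
  rw [h1, h3, ← Set.indicator_indicator]
  by_cases hx : x ∈ S
  · rw [Set.indicator_of_mem hx, Set.indicator_of_mem hx, h2]
  · rw [Set.indicator_of_notMem hx, Set.indicator_of_notMem hx]

theorem proj_empty : proj σ ∅ = 0 := by
  refine ContinuousLinearMap.ext fun f => Lp.ext ?_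
  filter_upwards [proj_apply_ae MeasurableSet.empty f, Lp.coeFn_zero ℂ 2 σ] with x h1 h2
  rw [h1, Set.indicator_empty, zero_apply, h2]
  rfl

theorem proj_mul_proj_of_disjoint {S T : Set X} (hS : MeasurableSet S) (hT : MeasurableSet T)
    (h : Disjoint S T) : proj σ S * proj σ T = 0 := by
  rw [proj_mul_proj hS hT, h.inter_eq, proj_empty]

theorem proj_commute {S T : Set X} (hS : MeasurableSet S) (hT : MeasurableSet T) :
    proj σ S * proj σ T = proj σ T * proj σ S := by
  rw [proj_mul_proj hS hT, proj_mul_proj hT hS, Set.inter_comm]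

theorem proj_mul_self {S : Set X} (hS : MeasurableSet S) : proj σ S * proj σ S = proj σ S := by
  rw [proj_mul_proj hS hS, Set.inter_self]

theorem star_proj (S : Set X) : star (proj σ S) = proj σ S :=
  isSelfAdjoint_starProjection (L2On σ S)

theorem opSqrt_mul_self {H : Type u} [NormedAddCommGroup H] [InnerProductSpace ℂ H]
    [CompleteSpace H] {K : H →L[ℂ] H} (h : 0 ≤ K) : opSqrt K * opSqrt K = K :=
  CFC.sqrt_mul_sqrt_self K h

theorem star_opSqrt {H : Type u} [NormedAddCommGroup H] [InnerProductSpace ℂ H]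
    [CompleteSpace H] (K : H →L[ℂ] H) : star (opSqrt K) = opSqrt K :=
  (IsSelfAdjoint.of_nonneg (CFC.sqrt_nonneg K)).star_eq

/-- If `P R R P = P A P` is of trace class, then `R P` is Hilbert–Schmidt. -/
theorem isHS_mul_proj {A R : L2 σ →L[ℂ] L2 σ} {Δ : Set X} (hR : star R = R)
    (h : R * R * proj σ Δ = A * proj σ Δ) (hA : IsTraceClass (proj σ Δ * A * proj σ Δ)) :
    IsHS (R * proj σ Δ) := by
  refine isHS_of_isTraceClass ?_
  rwa [star_mul, hR, star_proj, mul_assoc, ← mul_assoc R, h, ← mul_assoc]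

/-! ### The scalar term of the commutator -/

section Scalar

variable {a b p₁ p₂ q₁ q₂ : L2 σ →L[ℂ] L2 σ}

theorem mul_mul_eq_sub {R : Type*} [Ring R] {c d : R} (hcd : c * c + d * d = 1) (x : R) :
    d * (d * x) = x - c * (c * x) := by
  rw [← mul_assoc, ← mul_assoc, eq_sub_iff_add_eq', ← add_mul, hcd, one_mul]

/-- By `b² = 1 - a²`, the inner product is `⟨p₁ a, p₂ a⟩ - ⟨a p₁ a, a p₂ a⟩`. The first term is
symmetric because `p₁` and `p₂` commute, the second because both operators are self-adjoint. -/
theorem hsInner_comm_of_left (ha : star a = a) (hb : star b = b) (hab : a * a + b * b = 1)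
    (hp₁ : star p₁ = p₁) (hp₂ : star p₂ = p₂) (hi₁ : p₁ * p₁ = p₁)
    (hc : p₁ * p₂ = p₂ * p₁) (h₁ : IsHS (a * p₁)) (h₂ : IsHS (a * p₂)) :
    hsInner (b * p₁ * a) (b * p₂ * a) = hsInner (b * p₂ * a) (b * p₁ * a) := by
  have k₁ : IsHS (p₁ * a) := by simpa only [star_mul, ha, hp₁] using h₁.star
  have k₂ : IsHS (p₂ * a) := by simpa only [star_mul, ha, hp₂] using h₂.star
  have expand : ∀ {p p' : L2 σ →L[ℂ] L2 σ}, IsHS (p * a) → IsHS (p' * a) →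
      hsInner (b * p * a) (b * p' * a) =
        hsInner (p * a) (p' * a) - hsInner (a * (p * a)) (a * (p' * a)) := by
    intro p p' h h'
    have e1 := hsInner_mul_left b h (h'.mul_left b)
    have e2 := hsInner_mul_left a h (h'.mul_left a)
    rw [hb] at e1
    rw [ha] at e2
    rw [mul_assoc, mul_assoc, e1, e2, mul_mul_eq_sub hab,
      hsInner_sub_right _ h' ((h'.mul_left a).mul_left a)]
  have first : hsInner (p₁ * a) (p₂ * a) = hsInner (p₂ * a) (p₁ * a) := by
    have e1 := hsInner_mul_left p₁ k₁ k₂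
    have e2 := hsInner_mul_left p₂ k₁ k₁
    have e3 := hsInner_mul_left p₁ k₂ k₁
    have hk : p₁ * (p₁ * a) = p₁ * a := by rw [← mul_assoc, hi₁]
    have hc' : p₂ * (p₁ * a) = p₁ * (p₂ * a) := by rw [← mul_assoc, ← hc, mul_assoc]
    rw [hp₁, hk] at e1 e3
    rw [hp₂] at e2
    rw [e1, ← hc', ← e2, hc', e3]
  have second : hsInner (a * (p₁ * a)) (a * (p₂ * a)) = hsInner (a * (p₂ * a)) (a * (p₁ * a)) := by
    have e := hsInner_star (k₁.mul_left a) (k₂.mul_left a)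
    simpa only [star_mul, ha, hp₁, hp₂, mul_assoc] using e
  rw [expand k₁ k₂, expand k₂ k₁, first, second]

/-- Taking adjoints exchanges the roles of `a` and `b`. -/
theorem hsInner_comm_of_right (ha : star a = a) (hb : star b = b) (hab : a * a + b * b = 1)
    (hq₁ : star q₁ = q₁) (hq₂ : star q₂ = q₂) (hi₁ : q₁ * q₁ = q₁)
    (hc : q₁ * q₂ = q₂ * q₁) (h₁ : IsHS (b * q₁)) (h₂ : IsHS (b * q₂)) :
    hsInner (b * q₁ * a) (b * q₂ * a) = hsInner (b * q₂ * a) (b * q₁ * a) := by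
  have h := hsInner_comm_of_left hb ha (by rw [add_comm, hab]) hq₁ hq₂ hi₁ hc h₁ h₂
  have e1 := hsInner_star (h₁.mul_right a) (h₂.mul_right a)
  have e2 := hsInner_star (h₂.mul_right a) (h₁.mul_right a)
  simp only [star_mul, ha, hb, hq₁, hq₂, ← mul_assoc] at e1 e2
  rw [← e1, ← e2, h]

/-- For `p` and `q` with `q p = 0`, the inner product is `-‖q a² p‖²`, hence real. -/
theorem hsInner_comm_of_disjoint {p q : L2 σ →L[ℂ] L2 σ} (ha : star a = a) (hb : star b = b)
    (hab : a * a + b * b = 1) (hp : star p = p) (hq : star q = q) (hip : p * p = p)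
    (hiq : q * q = q) (hqp : q * p = 0) (h₁ : IsHS (a * p)) (h₂ : IsHS (b * q)) :
    hsInner (b * p * a) (b * q * a) = hsInner (b * q * a) (b * p * a) := by
  have k₁ : IsHS (p * a) := by simpa only [star_mul, ha, hp] using h₁.star
  have k₂ : IsHS (q * b) := by simpa only [star_mul, hb, hq] using h₂.star
  have u : IsHS (b * p * a) := by rw [mul_assoc]; exact k₁.mul_left b
  set N := q * a * (a * p) with hN
  have hNS : IsHS N := h₁.mul_left _
  have hN' : q * b * b * p = (-1 : L2 σ →L[ℂ] L2 σ) * N := by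
    have h := mul_mul_eq_sub hab p
    rw [mul_assoc, mul_assoc, h, mul_sub, hqp, hN]
    simp only [mul_assoc, zero_sub, neg_mul, one_mul]
  -- The factors are moved one at a time, so that every operator on the way is Hilbert–Schmidt.
  have hval : hsInner (b * p * a) (b * q * a) = hsInner ((-1 : L2 σ →L[ℂ] L2 σ) * N) N := by
    have e1 := hsInner_mul_right a u h₂
    have e2 := hsInner_star h₂ (u.mul_right a)
    have e3 := hsInner_mul_left q k₂ ((u.mul_right a).star)
    have e4 := hsInner_mul_right b k₂ hNS
    have e5 := hsInner_mul_right p (k₂.mul_right b) hNS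
    simp only [star_mul, ha, hb, hp, hq] at e1 e2 e3 e4 e5
    have e6 : q * (q * b) = q * b := by rw [← mul_assoc, hiq]
    have e7 : q * (a * (a * (p * b))) = N * b := by simp only [hN, mul_assoc]
    have e8 : N * p = N := by simp only [hN, mul_assoc, hip]
    rw [e6, e7] at e3
    rw [e8] at e5
    rw [← e1, ← e2, e3, ← e4, ← e5, hN']
  have hreal := hsInner_mul_left (-1) hNS hNS
  rw [star_neg, star_one] at hreal
  rw [← hsInner_conj_symm (b * p * a), hval, hsInner_conj_symm, hreal]

/-- The Hilbert–Schmidt inner product of `K₂ J_Δ K₁` and `K₂ J_Δ' K₁` is real. -/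
theorem hsInner_comm (ha : star a = a) (hb : star b = b) (hab : a * a + b * b = 1)
    (hp₁ : star p₁ = p₁) (hp₂ : star p₂ = p₂) (hq₁ : star q₁ = q₁) (hq₂ : star q₂ = q₂)
    (ip₁ : p₁ * p₁ = p₁) (ip₂ : p₂ * p₂ = p₂) (iq₁ : q₁ * q₁ = q₁) (iq₂ : q₂ * q₂ = q₂)
    (hp : p₁ * p₂ = p₂ * p₁) (hq : q₁ * q₂ = q₂ * q₁) (h₁₂ : q₁ * p₂ = 0) (h₂₁ : q₂ * p₁ = 0)
    (kp₁ : IsHS (a * p₁)) (kp₂ : IsHS (a * p₂)) (kq₁ : IsHS (b * q₁)) (kq₂ : IsHS (b * q₂)) :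
    hsInner (b * (p₁ - q₁) * a) (b * (p₂ - q₂) * a) =
      hsInner (b * (p₂ - q₂) * a) (b * (p₁ - q₁) * a) := by
  have hs : ∀ {p : L2 σ →L[ℂ] L2 σ}, star p = p → IsHS (a * p) → IsHS (b * p * a) := by
    intro p hp h
    have h' : IsHS (p * a) := by simpa only [star_mul, ha, hp] using h.star
    rw [mul_assoc]
    exact h'.mul_left b
  have u₁ := hs hp₁ kp₁
  have u₂ := hs hp₂ kp₂
  have v₁ := kq₁.mul_right a
  have v₂ := kq₂.mul_right a
  simp only [mul_sub, sub_mul]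
  rw [hsInner_sub_left _ u₁ v₁, hsInner_sub_left _ u₂ v₂, hsInner_sub_right _ u₂ v₂,
    hsInner_sub_right _ u₂ v₂, hsInner_sub_right _ u₁ v₁, hsInner_sub_right _ u₁ v₁,
    hsInner_comm_of_left ha hb hab hp₁ hp₂ ip₁ hp kp₁ kp₂,
    hsInner_comm_of_right ha hb hab hq₁ hq₂ iq₁ hq kq₁ kq₂,
    hsInner_comm_of_disjoint ha hb hab hp₁ hq₂ ip₁ iq₂ h₂₁ kp₁ kq₂,
    hsInner_comm_of_disjoint ha hb hab hp₂ hq₁ ip₂ iq₁ h₁₂ kp₂ kq₁]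
  ring

end Scalar

end Projections

section DoubledSpace

variable {X : Type u} [MeasurableSpace X] {σ : Measure X}

/-! ### Operators in the doubled space -/

theorem inner_incl₁ (f : L2 σ) (x : G2 σ) : ⟪incl₁ f, x⟫_ℂ = ⟪f, x.fst⟫_ℂ := by
  rw [WithLp.prod_inner_apply]
  change ⟪f, x.fst⟫_ℂ + ⟪(0 : L2 σ), x.snd⟫_ℂ = _
  rw [inner_zero_left, add_zero]

theorem inner_incl₂ (f : L2 σ) (x : G2 σ) : ⟪incl₂ f, x⟫_ℂ = ⟪f, x.snd⟫_ℂ := by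
  rw [WithLp.prod_inner_apply]
  change ⟪(0 : L2 σ), x.fst⟫_ℂ + ⟪f, x.snd⟫_ℂ = _
  rw [inner_zero_left, zero_add]

theorem opSum_apply (B D : L2 σ →L[ℂ] L2 σ) (x : G2 σ) :
    opSum B D x = incl₁ (B x.fst) + incl₂ (D x.snd) := by
  refine (WithLp.equiv 2 (L2 σ × L2 σ)).injective (Prod.ext ?_ ?_)
  · exact (add_zero (B x.fst)).symm
  · exact (zero_add (D x.snd)).symm

theorem opSum_incl₁ (B D : L2 σ →L[ℂ] L2 σ) (f : L2 σ) : opSum B D (incl₁ f) = incl₁ (B f) := by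
  rw [opSum_apply]
  change incl₁ (B f) + incl₂ (D 0) = _
  rw [map_zero, map_zero, add_zero]

theorem opSum_incl₂ (B D : L2 σ →L[ℂ] L2 σ) (f : L2 σ) : opSum B D (incl₂ f) = incl₂ (D f) := by
  rw [opSum_apply]
  change incl₁ (B 0) + incl₂ (D f) = _
  rw [map_zero, map_zero, zero_add]

theorem opSum_add (B D B' D' : L2 σ →L[ℂ] L2 σ) :
    opSum (B + B') (D + D') = opSum B D + opSum B' D' := by
  refine ContinuousLinearMap.ext fun x => ?_
  simp only [add_apply, opSum_apply, map_add]
  abel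

theorem opSum_sub (B D B' D' : L2 σ →L[ℂ] L2 σ) :
    opSum (B - B') (D - D') = opSum B D - opSum B' D' := by
  refine ContinuousLinearMap.ext fun x => ?_
  simp only [sub_apply, opSum_apply, map_sub]
  abel

theorem opSum_mul (B D B' D' : L2 σ →L[ℂ] L2 σ) :
    opSum B D * opSum B' D' = opSum (B * B') (D * D') := by
  refine ContinuousLinearMap.ext fun x => ?_
  rw [mul_apply_eq_comp, opSum_apply B', map_add, opSum_incl₁, opSum_incl₂, opSum_apply]
  rfl

theorem adjoint_opSum (B D : L2 σ →L[ℂ] L2 σ) :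
    ContinuousLinearMap.adjoint (opSum B D) = opSum (star B) (star D) := by
  refine ((ContinuousLinearMap.eq_adjoint_iff _ _).2 fun x y => ?_).symm
  rw [opSum_apply, opSum_apply, inner_add_left, inner_add_right, inner_incl₁, inner_incl₂,
    ← inner_conj_symm x, ← inner_conj_symm x, inner_incl₁, inner_incl₂, inner_conj_symm,
    inner_conj_symm, ContinuousLinearMap.star_eq_adjoint, ContinuousLinearMap.star_eq_adjoint,
    ContinuousLinearMap.adjoint_inner_left, ContinuousLinearMap.adjoint_inner_left]

theorem continuous_opSum {Y : Type*} [TopologicalSpace Y] {F F' : Y → L2 σ →L[ℂ] L2 σ}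
    (h : Continuous F) (h' : Continuous F') : Continuous fun y => opSum (F y) (F' y) := by
  have e : (fun y => opSum (F y) (F' y)) = fun y =>
      incl₁ ∘L F y ∘L WithLp.fstL 2 ℂ (L2 σ) (L2 σ) +
        incl₂ ∘L F' y ∘L WithLp.sndL 2 ℂ (L2 σ) (L2 σ) :=
    funext fun y => ContinuousLinearMap.ext fun x => opSum_apply (F y) (F' y) x
  rw [e]
  exact (continuous_const.clm_comp (h.clm_comp continuous_const)).add
    (continuous_const.clm_comp (h'.clm_comp continuous_const))

theorem embed₂₁_tmul (p q : L2 σ) :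
    embed₂₁ ((p ⊗ₜ[ℂ] q : L2 σ ⊗[ℂ] L2 σ) : Completion (L2 σ ⊗[ℂ] L2 σ)) =
      ((incl₂ p ⊗ₜ[ℂ] incl₁ q : G2 σ ⊗[ℂ] G2 σ) : Completion (G2 σ ⊗[ℂ] G2 σ)) :=
  ContinuousLinearMap.completion_apply_coe _ _

theorem legSum_embed₂₁ (B D : L2 σ →L[ℂ] L2 σ) (k : Completion (L2 σ ⊗[ℂ] L2 σ)) :
    legSum (opSum B D) (embed₂₁ k) =
      embed₂₁ ((D.rTensor (L2 σ)).completion k + (B.lTensor (L2 σ)).completion k) := by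
  induction k using completion_tensor_induction with
  | closed => exact isClosed_eq (by fun_prop) (by fun_prop)
  | zero => simp only [map_zero, add_zero]
  | add a b ha hb =>
    simp only [map_add] at ha hb ⊢
    rw [ha, hb]
    abel
  | tmul p q =>
    rw [embed₂₁_tmul, legSum_tmul, opSum_incl₂, opSum_incl₁, map_add,
      ContinuousLinearMap.completion_apply_coe, ContinuousLinearMap.completion_apply_coe,
      ContinuousLinearMap.rTensor_tmul, ContinuousLinearMap.lTensor_tmul, embed₂₁_tmul,
      embed₂₁_tmul]

/-- The action of `dΓ(conj B ⊕ D)` on the kernel of `T` in the sense of `legSum` gives the kernel of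
`D T + T B*`. -/
theorem legSum_embed₂₁_of_isKernelTensor {T : L2 σ →L[ℂ] L2 σ}
    {k : Completion (L2 σ ⊗[ℂ] L2 σ)} (hk : IsKernelTensor T k) (B D : L2 σ →L[ℂ] L2 σ) :
    legSum (opSum (conjOp B) D) (embed₂₁ k) = embed₂₁ (kernelTensor (D * T + T * star B)) := by
  have h := hk.mul_right (star B)
  rw [star_star] at h
  rw [legSum_embed₂₁, ((hk.mul_left D).add h).kernelTensor_eq]

/-! ### The commutator of annihilation and creation -/

/-- Normal ordering of two annihilation and two creation operators. -/
theorem normal_order {R : Type*} [Ring R] [Algebra ℂ R] {A₁ A₂ C₁ C₂ A C D : R} {α β : ℂ}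
    (hA : A = A₁ * A₂) (hC : C = C₂ * C₁) (hD : D = α • (C₁ * A₁) + β • (C₂ * A₂))
    (h₁₁ : A₁ * C₁ = β • 1 - C₁ * A₁) (h₂₂ : A₂ * C₂ = α • 1 - C₂ * A₂)
    (h₁₂ : A₁ * C₂ = -(C₂ * A₁)) (h₂₁ : A₂ * C₁ = -(C₁ * A₂)) :
    A * C + D = C * A + (α * β) • 1 := by
  have e1 : A₁ * A₂ * (C₂ * C₁) = A₁ * (A₂ * C₂) * C₁ := by simp only [mul_assoc]
  have e2 : A₁ * (C₂ * A₂) * C₁ = (A₁ * C₂) * (A₂ * C₁) := by simp only [mul_assoc]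
  have e3 : (C₂ * A₁) * (C₁ * A₂) = C₂ * (A₁ * C₁) * A₂ := by simp only [mul_assoc]
  have e4 : C₂ * (C₁ * A₁) * A₂ = C₂ * C₁ * (A₁ * A₂) := by simp only [mul_assoc]
  rw [hA, hC, hD, e1, h₂₂, mul_sub, sub_mul, e2, h₁₂, h₂₁, neg_mul_neg, e3, h₁₁, mul_sub, sub_mul, e4,
    mul_smul_comm, mul_one, smul_mul_assoc, h₁₁, mul_smul_comm, mul_one, smul_mul_assoc, smul_sub,
    smul_smul]
  abel

theorem opSum_rankOne (p q r s : L2 σ) :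
    opSum (conjOp (star (InnerProductSpace.rankOne ℂ p (conjL2 σ q)) *
        InnerProductSpace.rankOne ℂ r (conjL2 σ s)))
      (InnerProductSpace.rankOne ℂ p (conjL2 σ q) *
        star (InnerProductSpace.rankOne ℂ r (conjL2 σ s))) =
      ⟪r, p⟫_ℂ • InnerProductSpace.rankOne ℂ (incl₁ q) (incl₁ s) +
        ⟪s, q⟫_ℂ • InnerProductSpace.rankOne ℂ (incl₂ p) (incl₂ r) := by
  refine ContinuousLinearMap.ext fun x => ?_
  rw [opSum_apply, conjOp_apply, mul_apply_eq_comp, mul_apply_eq_comp,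
    ContinuousLinearMap.star_eq_adjoint, ContinuousLinearMap.star_eq_adjoint,
    InnerProductSpace.adjoint_rankOne, InnerProductSpace.adjoint_rankOne]
  simp only [InnerProductSpace.rankOne_apply, add_apply, smul_apply, inner_conjL2,
    inner_incl₁, inner_incl₂, ContinuousLinearMap.map_smulₛₗ, map_mul, conjL2_conjL2,
    inner_conj_symm, RingHom.id_apply, smul_smul]
  rw [mul_comm ⟪s, x.fst⟫_ℂ, mul_comm ⟪r, x.snd⟫_ℂ]

theorem annihilate₁_mul_create₁_of_inner_eq_zero {G : Type u} [NormedAddCommGroup G]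
    [InnerProductSpace ℂ G] {f g : G} (h : ⟪f, g⟫_ℂ = 0) :
    annihilate₁ f * create₁ g = -(create₁ g * annihilate₁ f) := by
  rw [annihilate₁_mul_create₁, h, zero_smul]
  exact LinearMap.ext fun v => zero_sub _

/-- The commutator of `a⁻(l₂₁)` and `a⁺(k₂₁)` for elementary tensors. -/
theorem annihilate₂_mul_create₂_tmul (p q r s : L2 σ) :
    (annihilate₂ (embed₂₁ ((r ⊗ₜ[ℂ] s : L2 σ ⊗[ℂ] L2 σ) : Completion (L2 σ ⊗[ℂ] L2 σ))) :
        Module.End ℂ (FockFin (G2 σ))) *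
        create₂ (embed₂₁ ((p ⊗ₜ[ℂ] q : L2 σ ⊗[ℂ] L2 σ) : Completion (L2 σ ⊗[ℂ] L2 σ))) +
      dGamma (opSum (conjOp (star (InnerProductSpace.rankOne ℂ p (conjL2 σ q)) *
        InnerProductSpace.rankOne ℂ r (conjL2 σ s)))
      (InnerProductSpace.rankOne ℂ p (conjL2 σ q) *
        star (InnerProductSpace.rankOne ℂ r (conjL2 σ s)))) =
      create₂ (embed₂₁ ((p ⊗ₜ[ℂ] q : L2 σ ⊗[ℂ] L2 σ) : Completion (L2 σ ⊗[ℂ] L2 σ))) *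
        annihilate₂ (embed₂₁ ((r ⊗ₜ[ℂ] s : L2 σ ⊗[ℂ] L2 σ) : Completion (L2 σ ⊗[ℂ] L2 σ))) +
      (⟪r, p⟫_ℂ * ⟪s, q⟫_ℂ) • 1 := by
  have o₁₂ : ⟪incl₁ s, incl₂ p⟫_ℂ = 0 := by
    rw [inner_incl₁]
    exact inner_zero_right s
  have o₂₁ : ⟪incl₂ r, incl₁ q⟫_ℂ = 0 := by
    rw [inner_incl₂]
    exact inner_zero_right r
  have i₁ : ⟪(incl₁ s : G2 σ), incl₁ q⟫_ℂ = ⟪s, q⟫_ℂ := inner_incl₁ s (incl₁ q)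
  have i₂ : ⟪(incl₂ r : G2 σ), incl₂ p⟫_ℂ = ⟪r, p⟫_ℂ := inner_incl₂ r (incl₂ p)
  have h₁₁ := annihilate₁_mul_create₁ (incl₁ s : G2 σ) (incl₁ q)
  have h₂₂ := annihilate₁_mul_create₁ (incl₂ r : G2 σ) (incl₂ p)
  have h₁₂ := annihilate₁_mul_create₁_of_inner_eq_zero o₁₂
  have h₂₁ := annihilate₁_mul_create₁_of_inner_eq_zero o₂₁
  rw [i₁] at h₁₁
  rw [i₂] at h₂₂
  have e₁ : create₂ (embed₂₁ ((p ⊗ₜ[ℂ] q : L2 σ ⊗[ℂ] L2 σ) : Completion (L2 σ ⊗[ℂ] L2 σ))) =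
      create₁ (incl₂ p) * create₁ (incl₁ q) := by
    rw [embed₂₁_tmul, create₂_tmul]
  have e₂ : annihilate₂ (embed₂₁ ((r ⊗ₜ[ℂ] s : L2 σ ⊗[ℂ] L2 σ) :
      Completion (L2 σ ⊗[ℂ] L2 σ))) = annihilate₁ (incl₁ s) * annihilate₁ (incl₂ r) := by
    rw [embed₂₁_tmul, annihilate₂_tmul]
  have e₃ : dGamma (opSum (conjOp (star (InnerProductSpace.rankOne ℂ p (conjL2 σ q)) *
        InnerProductSpace.rankOne ℂ r (conjL2 σ s)))
      (InnerProductSpace.rankOne ℂ p (conjL2 σ q) *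
        star (InnerProductSpace.rankOne ℂ r (conjL2 σ s)))) =
      ⟪r, p⟫_ℂ • (create₁ (incl₁ q) * annihilate₁ (incl₁ s)) +
        ⟪s, q⟫_ℂ • (create₁ (incl₂ p) * annihilate₁ (incl₂ r)) := by
    rw [opSum_rankOne, dGamma_add, dGamma_smul, dGamma_smul, dGamma_rankOne, dGamma_rankOne]
  exact normal_order (R := Module.End ℂ (FockFin (G2 σ))) e₂ e₁ e₃ h₁₁ h₂₂ h₁₂ h₂₁

/-- The defect of the commutation relation between `a⁻(l₂₁)` and `a⁺(k₂₁)`, an operator that turns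
out to vanish. -/
def commDefect (l k : Completion (L2 σ ⊗[ℂ] L2 σ)) (g : FockFin (G2 σ)) : FockFin (G2 σ) :=
  annihilate₂ (embed₂₁ l) (create₂ (embed₂₁ k) g) +
    dGamma (opSum (conjOp (star (kernelOp k) * kernelOp l)) (kernelOp k * star (kernelOp l))) g +
    -(create₂ (embed₂₁ k) (annihilate₂ (embed₂₁ l) g) + ⟪l, k⟫_ℂ • g)

theorem commDefect_add_right (l k k' : Completion (L2 σ ⊗[ℂ] L2 σ)) (g : FockFin (G2 σ)) :
    commDefect l (k + k') g = commDefect l k g + commDefect l k' g := by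
  simp only [commDefect, map_add, create₂_add, LinearMap.add_apply, star_add, add_mul,
    inner_add_right, add_smul, conjOp_add, opSum_add, dGamma_add]
  abel

theorem commDefect_add_left (l l' k : Completion (L2 σ ⊗[ℂ] L2 σ)) (g : FockFin (G2 σ)) :
    commDefect (l + l') k g = commDefect l k g + commDefect l' k g := by
  simp only [commDefect, map_add, annihilate₂_add, LinearMap.add_apply, star_add, mul_add,
    inner_add_left, add_smul, conjOp_add, opSum_add, dGamma_add]
  abel

theorem continuous_fock_neg {G : Type u} [NormedAddCommGroup G] [InnerProductSpace ℂ G]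
    {Y : Type*} [TopologicalSpace Y] {F : Y → FockFin G} (h : Continuous F) :
    Continuous fun y => -F y :=
  continuous_fock_iff.2 fun m => (continuous_fock_iff.1 h m).neg

theorem continuous_commDefect_right (l : Completion (L2 σ ⊗[ℂ] L2 σ)) (g : FockFin (G2 σ)) :
    Continuous fun k => commDefect l k g := by
  have hstar : Continuous fun B : L2 σ →L[ℂ] L2 σ => star B :=
    (ContinuousLinearMap.adjoint (𝕜 := ℂ) (E := L2 σ) (F := L2 σ)).continuous
  have hop : Continuous fun k : Completion (L2 σ ⊗[ℂ] L2 σ) => kernelOp k := kernelOp.continuous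
  have hc : ∀ g, Continuous fun k : Completion (L2 σ ⊗[ℂ] L2 σ) => create₂ (embed₂₁ k) g :=
    fun g => (continuous_create₂_left g).comp embed₂₁.continuous
  exact continuous_fock_add (continuous_fock_add ((continuous_annihilate₂ _).comp (hc g))
    ((continuous_dGamma_left g).comp (continuous_opSum (continuous_conjOp.comp
      ((hstar.comp hop).mul continuous_const)) (hop.mul continuous_const))))
    (continuous_fock_neg (continuous_fock_add (hc _) (continuous_fock_smul (by fun_prop) g)))

theorem continuous_commDefect_left (k : Completion (L2 σ ⊗[ℂ] L2 σ)) (g : FockFin (G2 σ)) :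
    Continuous fun l => commDefect l k g := by
  have hstar : Continuous fun B : L2 σ →L[ℂ] L2 σ => star B :=
    (ContinuousLinearMap.adjoint (𝕜 := ℂ) (E := L2 σ) (F := L2 σ)).continuous
  have hop : Continuous fun k : Completion (L2 σ ⊗[ℂ] L2 σ) => kernelOp k := kernelOp.continuous
  have ha : ∀ g, Continuous fun k : Completion (L2 σ ⊗[ℂ] L2 σ) => annihilate₂ (embed₂₁ k) g :=
    fun g => (continuous_annihilate₂_left g).comp embed₂₁.continuous
  exact continuous_fock_add (continuous_fock_add (ha _)
    ((continuous_dGamma_left g).comp (continuous_opSum (continuous_conjOp.comp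
      (continuous_const.mul hop)) (continuous_const.mul (hstar.comp hop)))))
    (continuous_fock_neg (continuous_fock_add ((continuous_create₂ _).comp (ha g))
      (continuous_fock_smul (by fun_prop) g)))

theorem commDefect_tmul (p q r s : L2 σ) (g : FockFin (G2 σ)) :
    commDefect ((r ⊗ₜ[ℂ] s : L2 σ ⊗[ℂ] L2 σ) : Completion (L2 σ ⊗[ℂ] L2 σ))
      ((p ⊗ₜ[ℂ] q : L2 σ ⊗[ℂ] L2 σ) : Completion (L2 σ ⊗[ℂ] L2 σ)) g = 0 := by
  rw [commDefect, kernelOp_coe, kernelOp_coe, preKernelOp_tmul, preKernelOp_tmul,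
    Completion.inner_coe, TensorProduct.inner_tmul, ← sub_eq_add_neg]
  exact sub_eq_zero.2 (DFunLike.congr_fun (annihilate₂_mul_create₂_tmul p q r s) g)

theorem commDefect_eq_zero (l k : Completion (L2 σ ⊗[ℂ] L2 σ)) (g : FockFin (G2 σ)) :
    commDefect l k g = 0 := by
  induction k using completion_tensor_induction with
  | closed => exact isClosed_eq (continuous_commDefect_right l g) continuous_const
  | zero =>
    have h := commDefect_add_right l 0 0 g
    rw [add_zero] at h
    exact left_eq_add.1 h
  | add a b ha hb => rw [commDefect_add_right, ha, hb, add_zero]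
  | tmul p q =>
    induction l using completion_tensor_induction with
    | closed => exact isClosed_eq (continuous_commDefect_left _ g) continuous_const
    | zero =>
      have h := commDefect_add_left 0 0
        ((p ⊗ₜ[ℂ] q : L2 σ ⊗[ℂ] L2 σ) : Completion (L2 σ ⊗[ℂ] L2 σ)) g
      rw [add_zero] at h
      exact left_eq_add.1 h
    | add a b ha hb => rw [commDefect_add_left, ha, hb, add_zero]
    | tmul r s => exact commDefect_tmul p q r s g

/-- The commutator of `a⁻(S₂₁)` and `a⁺(T₂₁)` for Hilbert–Schmidt operators `S` and `T`. -/
theorem annihilate₂_mul_create₂_of_isHS {S T : L2 σ →L[ℂ] L2 σ} (hS : IsHS S) (hT : IsHS T) :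
    (annihilate₂ (embed₂₁ (kernelTensor S)) : Module.End ℂ (FockFin (G2 σ))) *
        create₂ (embed₂₁ (kernelTensor T)) +
      dGamma (opSum (conjOp (star T * S)) (T * star S)) =
      create₂ (embed₂₁ (kernelTensor T)) * annihilate₂ (embed₂₁ (kernelTensor S)) +
        hsInner S T • 1 := by
  refine LinearMap.ext fun g => ?_
  have h := commDefect_eq_zero (kernelTensor S) (kernelTensor T) g
  rw [commDefect, ← IsKernelTensor.eq_kernelOp hS, ← IsKernelTensor.eq_kernelOp hT,
    ← sub_eq_add_neg] at h
  exact sub_eq_zero.1 h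

end DoubledSpace

section Commutation

/-! ### Commutation of the particle densities -/

/-- The algebraic identity behind the commutation of two sums of creation parts `c`, annihilation
parts `n`, number-preserving parts `d` and scalars `t`: the commutators of `d` with `c` and with `n`
cancel by symmetry, and so do the scalar parts `s` of the commutators of `n` with `c`, whose
number-preserving parts `m` cancel against the commutator `w` of the `d`'s. -/
theorem density_mul_comm {R : Type*} [Ring R] [Algebra ℂ R] {c₁ c₂ n₁ n₂ d₁ d₂ e f m₁₂ m₂₁ w : R}
    {s t₁ t₂ : ℂ} (hc : c₁ * c₂ = c₂ * c₁) (hn : n₁ * n₂ = n₂ * n₁)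
    (h₁ : d₁ * c₂ = c₂ * d₁ + e) (h₂ : d₂ * c₁ = c₁ * d₂ + e)
    (h₃ : n₁ * d₂ = d₂ * n₁ + f) (h₄ : n₂ * d₁ = d₁ * n₂ + f)
    (h₅ : n₁ * c₂ + m₁₂ = c₂ * n₁ + s • 1) (h₆ : n₂ * c₁ + m₂₁ = c₁ * n₂ + s • 1)
    (h₇ : d₁ * d₂ = d₂ * d₁ + w) (h₈ : w + m₂₁ = m₁₂) :
    (c₁ + n₁ + d₁ + t₁ • 1) * (c₂ + n₂ + d₂ + t₂ • 1) =
      (c₂ + n₂ + d₂ + t₂ • 1) * (c₁ + n₁ + d₁ + t₁ • 1) := by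
  have h₅' : n₁ * c₂ = c₂ * n₁ + s • 1 - m₁₂ := eq_sub_of_add_eq h₅
  have h₆' : n₂ * c₁ = c₁ * n₂ + s • 1 - m₂₁ := eq_sub_of_add_eq h₆
  simp only [mul_add, add_mul, smul_mul_assoc, mul_smul_comm, one_mul, mul_one, smul_add]
  rw [hc, hn, h₁, h₂, h₃, h₄, h₅', h₆', h₇, ← h₈, smul_comm t₁ t₂]
  abel

/-- The kernels that arise in the commutators of the number-preserving parts with the creation
parts are symmetric in the two densities. -/
theorem kernel_term_symm {R : Type*} [Ring R] {a b j₁ j₂ : R} (hab : a * a + b * b = 1)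
    (hj : j₁ * j₂ = j₂ * j₁) :
    b * j₁ * b * (b * j₂ * a) + b * j₂ * a * (-(a * j₁ * a)) =
      b * j₂ * b * (b * j₁ * a) + b * j₁ * a * (-(a * j₂ * a)) := by
  have hj' : ∀ x, j₁ * (j₂ * x) = j₂ * (j₁ * x) := fun x => by
    rw [← mul_assoc, hj, mul_assoc]
  simp only [mul_assoc, mul_mul_eq_sub hab, mul_sub, mul_neg, hj']
  abel

/-- The first component of `[dΓ, dΓ]` cancels against that of the number-preserving part of
`[a⁻, a⁺]`. -/
theorem commutator_term_left {R : Type*} [Ring R] {a b j₁ j₂ : R} (hab : a * a + b * b = 1)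
    (hj : j₁ * j₂ = j₂ * j₁) :
    -(a * j₁ * a) * -(a * j₂ * a) - -(a * j₂ * a) * -(a * j₁ * a) +
      a * j₁ * b * (b * j₂ * a) = a * j₂ * b * (b * j₁ * a) := by
  have hj' : ∀ x, j₁ * (j₂ * x) = j₂ * (j₁ * x) := fun x => by
    rw [← mul_assoc, hj, mul_assoc]
  simp only [mul_assoc, mul_mul_eq_sub hab, mul_sub, neg_mul_neg, hj']
  abel

/-- The second component of `[dΓ, dΓ]` cancels against that of the number-preserving part of
`[a⁻, a⁺]`. -/
theorem commutator_term_right {R : Type*} [Ring R] {a b j₁ j₂ : R} (hab : a * a + b * b = 1)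
    (hj : j₁ * j₂ = j₂ * j₁) :
    b * j₁ * b * (b * j₂ * b) - b * j₂ * b * (b * j₁ * b) +
      b * j₁ * a * (a * j₂ * b) = b * j₂ * a * (a * j₁ * b) := by
  have hj' : ∀ x, j₁ * (j₂ * x) = j₂ * (j₁ * x) := fun x => by
    rw [← mul_assoc, hj, mul_assoc]
  simp only [mul_assoc, mul_mul_eq_sub hab, mul_sub, hj']
  abel

variable {X : Type u} [MeasurableSpace X] {σ : Measure X}

/-- Commutation of the densities built from operators `a = K₁`, `b = K₂`, `jᵢ = J_{Δᵢ}`. -/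
theorem density_commute {a b j₁ j₂ : L2 σ →L[ℂ] L2 σ} (ha : star a = a) (hb : star b = b)
    (hab : a * a + b * b = 1) (hj₁ : star j₁ = j₁) (hj₂ : star j₂ = j₂) (hj : j₁ * j₂ = j₂ * j₁)
    (hT₁ : IsHS (b * j₁ * a)) (hT₂ : IsHS (b * j₂ * a))
    (hreal : hsInner (b * j₁ * a) (b * j₂ * a) = hsInner (b * j₂ * a) (b * j₁ * a)) (t₁ t₂ : ℂ) :
    ((create₂ (embed₂₁ (kernelTensor (b * j₁ * a))) +
        annihilate₂ (embed₂₁ (kernelTensor (b * j₁ * a))) +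
        dGamma (opSum (conjOp (-(a * j₁ * a))) (b * j₁ * b)) + t₁ • 1 :
          Module.End ℂ (FockFin (G2 σ)))) *
      (create₂ (embed₂₁ (kernelTensor (b * j₂ * a))) +
        annihilate₂ (embed₂₁ (kernelTensor (b * j₂ * a))) +
        dGamma (opSum (conjOp (-(a * j₂ * a))) (b * j₂ * b)) + t₂ • 1 :
          Module.End ℂ (FockFin (G2 σ))) =
      (create₂ (embed₂₁ (kernelTensor (b * j₂ * a))) +
        annihilate₂ (embed₂₁ (kernelTensor (b * j₂ * a))) +
        dGamma (opSum (conjOp (-(a * j₂ * a))) (b * j₂ * b)) + t₂ • 1 :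
          Module.End ℂ (FockFin (G2 σ))) *
      (create₂ (embed₂₁ (kernelTensor (b * j₁ * a))) +
        annihilate₂ (embed₂₁ (kernelTensor (b * j₁ * a))) +
        dGamma (opSum (conjOp (-(a * j₁ * a))) (b * j₁ * b)) + t₁ • 1 :
          Module.End ℂ (FockFin (G2 σ))) := by
  have sB₁ : star (-(a * j₁ * a)) = -(a * j₁ * a) := by
    simp only [star_neg, star_mul, ha, hj₁, mul_assoc]
  have sB₂ : star (-(a * j₂ * a)) = -(a * j₂ * a) := by
    simp only [star_neg, star_mul, ha, hj₂, mul_assoc]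
  have sD₁ : star (b * j₁ * b) = b * j₁ * b := by simp only [star_mul, hb, hj₁, mul_assoc]
  have sD₂ : star (b * j₂ * b) = b * j₂ * b := by simp only [star_mul, hb, hj₂, mul_assoc]
  have sT₁ : star (b * j₁ * a) = a * j₁ * b := by simp only [star_mul, ha, hb, hj₁, mul_assoc]
  have sT₂ : star (b * j₂ * a) = a * j₂ * b := by simp only [star_mul, ha, hb, hj₂, mul_assoc]
  have aD₁ := adjoint_opSum (conjOp (-(a * j₁ * a))) (b * j₁ * b)
  have aD₂ := adjoint_opSum (conjOp (-(a * j₂ * a))) (b * j₂ * b)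
  rw [star_conjOp, sB₁, sD₁] at aD₁
  rw [star_conjOp, sB₂, sD₂] at aD₂
  have l₁ := legSum_embed₂₁_of_isKernelTensor hT₂ (-(a * j₁ * a)) (b * j₁ * b)
  have l₂ := legSum_embed₂₁_of_isKernelTensor hT₁ (-(a * j₂ * a)) (b * j₂ * b)
  rw [sB₁, kernel_term_symm hab hj] at l₁
  rw [sB₂] at l₂
  have h₁ := dGamma_mul_create₂ (opSum (conjOp (-(a * j₁ * a))) (b * j₁ * b))
    (embed₂₁ (kernelTensor (b * j₂ * a)))
  have h₂ := dGamma_mul_create₂ (opSum (conjOp (-(a * j₂ * a))) (b * j₂ * b))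
    (embed₂₁ (kernelTensor (b * j₁ * a)))
  have h₃ := annihilate₂_mul_dGamma (opSum (conjOp (-(a * j₂ * a))) (b * j₂ * b))
    (embed₂₁ (kernelTensor (b * j₁ * a)))
  have h₄ := annihilate₂_mul_dGamma (opSum (conjOp (-(a * j₁ * a))) (b * j₁ * b))
    (embed₂₁ (kernelTensor (b * j₂ * a)))
  have h₅ := annihilate₂_mul_create₂_of_isHS hT₁ hT₂
  have h₆ := annihilate₂_mul_create₂_of_isHS hT₂ hT₁
  rw [l₁] at h₁
  rw [l₂] at h₂
  rw [aD₂, l₂] at h₃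
  rw [aD₁, l₁] at h₄
  rw [hreal] at h₅
  have hw : opSum (conjOp (-(a * j₁ * a))) (b * j₁ * b) * opSum (conjOp (-(a * j₂ * a))) (b * j₂ * b) -
        opSum (conjOp (-(a * j₂ * a))) (b * j₂ * b) * opSum (conjOp (-(a * j₁ * a))) (b * j₁ * b) +
      opSum (conjOp (star (b * j₁ * a) * (b * j₂ * a))) (b * j₁ * a * star (b * j₂ * a)) =
      opSum (conjOp (star (b * j₂ * a) * (b * j₁ * a))) (b * j₂ * a * star (b * j₁ * a)) := by
    rw [opSum_mul, opSum_mul, ← opSum_sub, ← conjOp_mul, ← conjOp_mul, ← conjOp_sub, ← opSum_add,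
      ← conjOp_add, sT₁, sT₂]
    exact congrArg₂ (fun B D => opSum (conjOp B) D) (commutator_term_left hab hj) (commutator_term_right hab hj)
  exact density_mul_comm (R := Module.End ℂ (FockFin (G2 σ))) (commute_create₂ _ _)
    (commute_annihilate₂ _ _) h₁ h₂ h₃ h₄ h₅ h₆ (dGamma_mul_dGamma _ _)
    ((dGamma_add _ _).symm.trans (congrArg dGamma hw))

theorem IsPrecompact.inter [TopologicalSpace X] {Δ Y : Set X} (hΔ : IsPrecompact Δ)
    (hY : MeasurableSet Y) : IsPrecompact (Δ ∩ Y) :=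
  ⟨hΔ.1.inter hY, hΔ.2.of_isClosed_subset isClosed_closure (closure_mono Set.inter_subset_left)⟩

variable {X₁ X₂ Δ : Set X} {A : L2 σ →L[ℂ] L2 σ}

theorem hatOp_mul_proj_left (hX₁ : MeasurableSet X₁) (hX₂ : MeasurableSet X₂)
    (hdisj : Disjoint X₁ X₂) (hΔ : MeasurableSet Δ) (h : Δ ⊆ X₁) :
    hatOp X₁ X₂ A * proj σ Δ = A * proj σ Δ := by
  rw [hatOp, add_mul, mul_assoc, mul_assoc, proj_mul_proj hX₁ hΔ,
    proj_mul_proj_of_disjoint hX₂ hΔ (hdisj.symm.mono_right h), mul_zero, add_zero,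
    Set.inter_eq_right.2 h]

theorem one_sub_hatOp_mul_proj_right (hX₁ : MeasurableSet X₁) (hX₂ : MeasurableSet X₂)
    (hdisj : Disjoint X₁ X₂) (hΔ : MeasurableSet Δ) (h : Δ ⊆ X₂) :
    (1 - hatOp X₁ X₂ A) * proj σ Δ = A * proj σ Δ := by
  rw [hatOp, sub_mul, add_mul, mul_assoc, mul_assoc, proj_mul_proj hX₂ hΔ,
    proj_mul_proj_of_disjoint hX₁ hΔ (hdisj.mono_right h), mul_zero, zero_add,
    Set.inter_eq_right.2 h, sub_mul, one_mul, sub_sub_cancel]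

end Commutation

end

end ParticleDensity

open ParticleDensity
theorem mainTheorem4 {X : Type*} [TopologicalSpace X] [PolishSpace X] [LocallyCompactSpace X]
    [MeasurableSpace X] [BorelSpace X] (σ : Measure X) [IsLocallyFiniteMeasure σ]
    (X₁ X₂ : Set X) (hX₁ : MeasurableSet X₁) (hX₂ : MeasurableSet X₂)
    (hdisj : Disjoint X₁ X₂) (hunion : X₁ ∪ X₂ = Set.univ)
    (A : L2 σ →L[ℂ] L2 σ) (hJ : IsJSelfAdjoint X₁ X₂ A)
    (hpos : 0 ≤ hatOp X₁ X₂ A) (hle : hatOp X₁ X₂ A ≤ 1)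
    (htr₁ : IsLocallyTraceClassOn A X₁) (htr₂ : IsLocallyTraceClassOn A X₂)
    (Δ₁ Δ₂ : Set X) (hΔ₁ : IsPrecompact Δ₁) (hΔ₂ : IsPrecompact Δ₂) :
    particleDensity X₁ X₂ A Δ₁ * particleDensity X₁ X₂ A Δ₂ =
      particleDensity X₁ X₂ A Δ₂ * particleDensity X₁ X₂ A Δ₁ := by
  have ha := star_opSqrt (hatOp X₁ X₂ A)
  have hb := star_opSqrt (1 - hatOp X₁ X₂ A)
  have haa := opSqrt_mul_self hpos
  have hbb := opSqrt_mul_self (sub_nonneg.2 hle)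
  have hab : opSqrt (hatOp X₁ X₂ A) * opSqrt (hatOp X₁ X₂ A) +
      opSqrt (1 - hatOp X₁ X₂ A) * opSqrt (1 - hatOp X₁ X₂ A) = 1 := by
    rw [haa, hbb, add_sub_cancel]
  have kp : ∀ Δ : Set X, IsPrecompact Δ →
      IsHS (opSqrt (hatOp X₁ X₂ A) * proj σ (Δ ∩ X₁)) := fun Δ hΔ =>
    isHS_mul_proj ha (by
      rw [haa, hatOp_mul_proj_left hX₁ hX₂ hdisj (hΔ.1.inter hX₁) Set.inter_subset_right])
      (htr₁ _ (hΔ.inter hX₁) Set.inter_subset_right)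
  have kq : ∀ Δ : Set X, IsPrecompact Δ →
      IsHS (opSqrt (1 - hatOp X₁ X₂ A) * proj σ (Δ ∩ X₂)) := fun Δ hΔ =>
    isHS_mul_proj hb (by
      rw [hbb, one_sub_hatOp_mul_proj_right hX₁ hX₂ hdisj (hΔ.1.inter hX₂)
        Set.inter_subset_right]) (htr₂ _ (hΔ.inter hX₂) Set.inter_subset_right)
  have hT : ∀ Δ : Set X, IsPrecompact Δ →
      IsHS (opSqrt (1 - hatOp X₁ X₂ A) * jProj σ X₁ X₂ Δ * opSqrt (hatOp X₁ X₂ A)) := by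
    intro Δ hΔ
    have h := (kp Δ hΔ).star
    rw [star_mul, ha, star_proj] at h
    have h' := (h.mul_left (opSqrt (1 - hatOp X₁ X₂ A))).sub
      ((kq Δ hΔ).mul_right (opSqrt (hatOp X₁ X₂ A)))
    rwa [← mul_assoc, ← sub_mul, ← mul_sub] at h'
  have hstar : ∀ Δ : Set X, star (jProj σ X₁ X₂ Δ) = jProj σ X₁ X₂ Δ := fun Δ => by
    rw [jProj, star_sub, star_proj, star_proj]
  have m₁₁ := hΔ₁.1.inter hX₁
  have m₁₂ := hΔ₁.1.inter hX₂
  have m₂₁ := hΔ₂.1.inter hX₁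
  have m₂₂ := hΔ₂.1.inter hX₂
  have hd : ∀ Δ Δ' : Set X, Disjoint (Δ ∩ X₂) (Δ' ∩ X₁) := fun Δ Δ' =>
    hdisj.symm.mono Set.inter_subset_right Set.inter_subset_right
  have hj : jProj σ X₁ X₂ Δ₁ * jProj σ X₁ X₂ Δ₂ = jProj σ X₁ X₂ Δ₂ * jProj σ X₁ X₂ Δ₁ := by
    simp only [jProj, mul_sub, sub_mul]
    rw [proj_commute m₁₁ m₂₁, proj_commute m₁₂ m₂₁, proj_commute m₁₁ m₂₂, proj_commute m₁₂ m₂₂]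
    abel
  have hreal := hsInner_comm ha hb hab (star_proj (Δ₁ ∩ X₁)) (star_proj (Δ₂ ∩ X₁))
    (star_proj (Δ₁ ∩ X₂)) (star_proj (Δ₂ ∩ X₂)) (proj_mul_self m₁₁) (proj_mul_self m₂₁)
    (proj_mul_self m₁₂) (proj_mul_self m₂₂) (proj_commute m₁₁ m₂₁) (proj_commute m₁₂ m₂₂)
    (proj_mul_proj_of_disjoint m₁₂ m₂₁ (hd _ _)) (proj_mul_proj_of_disjoint m₂₂ m₁₁ (hd _ _))
    (kp Δ₁ hΔ₁) (kp Δ₂ hΔ₂) (kq Δ₁ hΔ₁) (kq Δ₂ hΔ₂)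
  exact density_commute ha hb hab (hstar Δ₁) (hstar Δ₂) hj (hT Δ₁ hΔ₁) (hT Δ₂ hΔ₂) hreal _ _
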